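/- Let $F\subseteq\mathbb R$ be a subfield and let $V=\bigcup_k V_k$ be a filtered $F$-Euclidean lattice space: $V_1\subseteq V_2\subseteq\cdots$ are finite-dimensional real vector spaces with lattices $\Lambda_k\subset V_k$ such that $\Lambda_{k+1}\cap V_k=\Lambda_k$, and $Q$ is an inner product on $V$ taking values in $F$ on $\Lambda_V=\bigcup_k\Lambda_k$. Write $\Lambda_V\otimes F\subseteq V$ for the $F$-span of $\Lambda_V$; its elements are viewed as linear forms on the spaces $V_k^*\otimes\mathbb C$. Let $K$ be a field with $F\subseteq K\subseteq\mathbb C$ (for instance $K=F$ or $K=\mathbb C$). Let $\mathcal M$ be the union over $k$ (germs on $V_k^*\otimes\mathbb C$ being pulled back to $V_{k+1}^*\otimes\mathbb C$ by restriction) of the spaces of meromorphic germs $f$ at zero on $V_k^*\otimes\mathbb C$ for which there are nonzero $L_1,\dots,L_n\in\Lambda_V\otimes F$ such that $fL_1\cdots L_n$ is a holomorphic germ whose Taylor coefficients, in the coordinates given by a basis of $\Lambda_k$, lie in $K$. A polar germ is a germ $h(\ell_1,\dots,\ell_m)/(L_1^{s_1}\cdots L_n^{s_n})$ with $m,n\ge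 0$, $\ell_1,\dots,\ell_m\in\Lambda_V\otimes F$ linearly independent, $L_1,\dots,L_n\in\Lambda_V\otimes F$ linearly independent, $Q(\ell_i,L_j)=0$ for all $i,j$, integers $s_j\ge1$, and $h$ a holomorphic germ at $0\in\mathbb C^m$ with Taylor coefficients in $K$. Its supporting subspace is $\operatorname{span}_F(L_1,\dots,L_n)$ and its p-order is $s_1+\cdots+s_n$. Let $\mathcal M_U^p$ be the $K$-span of the polar germs with supporting subspace $U$ and p-order $p$. Then $$\mathcal M=\bigoplus_{U,\;p\ge 0}\mathcal M_U^p ,$$ where $U$ runs over the $F$-subspaces of $V$. Let $P_U^p:\mathcal M\to\mathcal M_U^p$ be the projections. Let $\Delta\subset\Lambda_V\otimes F$ be a finite set of nonzero vectors, $U=\operatorname{span}_F(\Delta)$ and $r=\dim U$. Let $S(U)$ be the algebra of polynomials with coefficients in $K$ in the linear forms from $U$, and let $R_\Delta=\Delta^{-1}S(U)\subseteq\mathcal M$, graded by total degree, $R_\Delta=\bigoplus_{j\in\mathbb Z}R_\Delta[j]$. Call $\kappa\subseteq\Delta$ generating if it spans $U$, and put $$G_\Delta=\operatorname{span}_K\Big\{\tfrac1{\prod_{\alpha\in\kappa}\alpha^{n_\alpha}}:\kappa\subseteq\Delta\text{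 generating},\ n_\alpha\ge1\Big\},\qquad S_\Delta=\operatorname{span}_K\Big\{\tfrac1{\prod_{\alpha\in\kappa}\alpha}:\kappa\subseteq\Delta\text{ a basis of }U\Big\},$$ $$NG_\Delta=\operatorname{span}_K\Big\{\tfrac h{\prod_{\alpha\in\kappa}\alpha^{n_\alpha}}:\kappa\subseteq\Delta\text{ not generating},\ n_\alpha\ge0,\ h\in S(U)\Big\}.$$ Then, with $G_\Delta[<-r]=G_\Delta\cap R_\Delta[<-r]$, $$R_\Delta=R_\Delta[>-r]\ \oplus\ (NG_\Delta\cap R_\Delta[\le -r])\ \oplus\ G_\Delta[<-r]\ \oplus\ S_\Delta .$$ The Jeffrey–Kirwan residue of $f\in R_\Delta$ (in Brion–Vergne's formulation) is its component in $S_\Delta$. For every $f\in R_\Delta$, the projection $P_U^r(f)$ is the Jeffrey–Kirwan residue of $f$. -/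

import Mathlib

open Filter Topology

noncomputable section

namespace LinearPoles

/-- A filtered `F`-Euclidean lattice space: a real vector space `V` that is the union of an
increasing sequence of finite-dimensional subspaces `space k`, each with a lattice `lattice k`
(the `ℤ`-span of an `ℝ`-basis of `space k`), such that `lattice (k + 1) ∩ space k = lattice k`, and
with an inner product `Q` taking values in `F` on lattice vectors. (A compatible sequence of inner
products on the spaces `space k` is the same thing as one inner product on their union.) -/
structure FilteredLatticeSpace (F : Subfield ℝ) (V : Type*) [AddCommGroup V] [Module ℝ V] where
  space : ℕ → Submodule ℝ V
  space_mono : Monotone space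
  space_exhaust : ∀ v : V, ∃ k, v ∈ space k
  lattice : ℕ → AddSubgroup V
  lattice_basis : ∀ k, ∃ (n : ℕ) (e : Fin n → V), LinearIndependent ℝ e ∧
    Submodule.span ℝ (Set.range e) = space k ∧ AddSubgroup.closure (Set.range e) = lattice k
  lattice_compat : ∀ k (v : V), v ∈ lattice k ↔ v ∈ lattice (k + 1) ∧ v ∈ space k
  Q : LinearMap.BilinForm ℝ V
  Q_symm : ∀ u v : V, Q u v = Q v u
  Q_pos : ∀ v : V, v ≠ 0 → 0 < Q v v
  Q_lattice : ∀ k, ∀ u ∈ lattice k, ∀ v ∈ lattice k, Q u v ∈ F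

variable {F : Subfield ℝ} {V : Type*} [AddCommGroup V] [Module ℝ V]

/-- `Λ_V ⊗ F`, i.e. the `F`-span in `V` of the union of the lattices. -/
def FilteredLatticeSpace.vectors (E : FilteredLatticeSpace F V) : Submodule F V :=
  Submodule.span F (⋃ k, (E.lattice k : Set V))

/-- The filter on the complex dual `Hom_ℝ(V, ℂ)` of "points near zero lying off finitely many
hyperplanes `L = 0`", with `0 ≠ L ∈ Λ_V ⊗ F`. Neighbourhoods of zero are those of the topology of
pointwise convergence, that is, preimages of neighbourhoods of zero under the restriction maps to
`Hom_ℝ(V_k, ℂ) = V_k^* ⊗ ℂ`. -/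
def FilteredLatticeSpace.offPoles (E : FilteredLatticeSpace F V) : Filter (V →ₗ[ℝ] ℂ) :=
  Filter.comap (fun (x : V →ₗ[ℝ] ℂ) (v : V) => x v) (𝓝 (0 : V → ℂ)) ⊓
    ⨅ L ∈ {L : V | L ∈ E.vectors ∧ L ≠ 0}, 𝓟 {x : V →ₗ[ℝ] ℂ | x L ≠ 0}

/-- The ring of germs at zero of functions defined off finitely many hyperplanes. A meromorphic germ
at zero with linear poles is determined by its values off its poles, hence is an element of this
ring, in which nonzero linear forms from `Λ_V ⊗ F` are invertible. A germ on `V_k^* ⊗ ℂ` is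
regarded as a germ on `Hom_ℝ(V, ℂ)` through the restriction map, so that the direct limit over `k`
is a union inside this ring. -/
abbrev FilteredLatticeSpace.Germs (E : FilteredLatticeSpace F V) : Type _ :=
  Filter.Germ E.offPoles ℂ

/-- Functions on `ℂ^m` that are, near zero, the sum of a convergent power series with coefficients
in `K`: representatives of the holomorphic germs at zero with Taylor coefficients in `K`. -/
def IsHolomorphicAtZero (K : Subfield ℂ) {m : ℕ} (h : (Fin m → ℂ) → ℂ) : Prop :=
  ∃ c : (Fin m → ℕ) → K, ∀ᶠ z in 𝓝 (0 : Fin m → ℂ),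
    HasSum (fun a : Fin m → ℕ => (c a : ℂ) * ∏ i, z i ^ a i) (h z)

/-- The germ `h(ℓ_1, …, ℓ_m)`, where a vector `ℓ` of `V` is the linear form `x ↦ x ℓ`. -/
def germOf (E : FilteredLatticeSpace F V) {m : ℕ} (h : (Fin m → ℂ) → ℂ) (ℓ : Fin m → V) :
    E.Germs :=
  ((fun x : V →ₗ[ℝ] ℂ => h (fun i => x (ℓ i)) : (V →ₗ[ℝ] ℂ) → ℂ) : E.Germs)

/-- The germ of the linear form defined by a vector `v`. -/
def lin (E : FilteredLatticeSpace F V) (v : V) : E.Germs :=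
  ((fun x : V →ₗ[ℝ] ℂ => x v : (V →ₗ[ℝ] ℂ) → ℂ) : E.Germs)

/-- Holomorphic germs at zero on some `V_k^* ⊗ ℂ` whose Taylor coefficients, in the coordinates
given by a basis of the lattice `Λ_k`, lie in `K`. -/
def IsHolomorphicGerm (E : FilteredLatticeSpace F V) (K : Subfield ℂ) (g : E.Germs) : Prop :=
  ∃ (k n : ℕ) (e : Fin n → V) (h : (Fin n → ℂ) → ℂ), LinearIndependent ℝ e ∧
    Submodule.span ℝ (Set.range e) = E.space k ∧
    AddSubgroup.closure (Set.range e) = E.lattice k ∧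
    IsHolomorphicAtZero K h ∧ g = germOf E h e

/-- `f` is a meromorphic germ at zero with linear poles in `Λ_V ⊗ F` and coefficients in `K`. -/
def IsMeromorphicGerm (E : FilteredLatticeSpace F V) (K : Subfield ℂ) (f : E.Germs) : Prop :=
  ∃ (n : ℕ) (L : Fin n → V), (∀ i, L i ∈ E.vectors ∧ L i ≠ 0) ∧
    IsHolomorphicGerm E K (f * ∏ i, lin E (L i))

/-- `f = h(ℓ_1, …, ℓ_m) / (L_1 ^ s_1 ⋯ L_n ^ s_n)` is a polar germ with coefficients in `K`, with
supporting subspace `U` (the span of the `L_i`) and p-order `p = s_1 + ⋯ + s_n`. For `n = 0` these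
are the holomorphic germs. -/
def IsPolarGerm (E : FilteredLatticeSpace F V) (K : Subfield ℂ) (U : Submodule F V) (p : ℕ)
    (f : E.Germs) : Prop :=
  ∃ (m n : ℕ) (ℓ : Fin m → V) (L : Fin n → V) (s : Fin n → ℕ) (h : (Fin m → ℂ) → ℂ),
    (∀ i, ℓ i ∈ E.vectors) ∧ (∀ j, L j ∈ E.vectors) ∧
    LinearIndependent ℝ ℓ ∧ LinearIndependent ℝ L ∧ (∀ i j, E.Q (ℓ i) (L j) = 0) ∧
    (∀ j, 0 < s j) ∧ IsHolomorphicAtZero K h ∧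
    Submodule.span F (Set.range L) = U ∧ ∑ j, s j = p ∧
    f = germOf E h ℓ / ∏ j, lin E (L j) ^ s j

/-- The space spanned by the polar germs with supporting subspace `U` and p-order `p`. -/
def polarSpace (E : FilteredLatticeSpace F V) (K : Subfield ℂ) (U : Submodule F V) (p : ℕ) :
    Submodule K E.Germs :=
  Submodule.span K {f | IsPolarGerm E K U p f}

/-- The component in `A i` of an element `f` of a direct sum of submodules `A j` (and zero if `f` is
not in their sum). It is well defined when the submodules are independent. -/
def component {R M ι : Type*} [Ring R] [AddCommGroup M] [Module R M] (A : ι → Submodule R M)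
    (i : ι) (f : M) : M :=
  open Classical in
  if h : ∃ c : ι →₀ M, (∀ j, c j ∈ A j) ∧ (c.sum fun _ x => x) = f then h.choose i else 0

/-- The projection `P_U^p` onto the space of polar germs with supporting subspace `U` and
p-order `p`, along all the other spaces of this kind. -/
def polarProj (E : FilteredLatticeSpace F V) (K : Subfield ℂ) (U : Submodule F V) (p : ℕ)
    (f : E.Germs) : E.Germs :=
  component (fun i : Submodule F V × ℕ => polarSpace E K i.1 i.2) (U, p) f

/-- `S(U)`: polynomials with coefficients in `K` in the linear forms from `U`, that is, the span of
the finite products of such forms. -/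
def symAlg (E : FilteredLatticeSpace F V) (K : Subfield ℂ) (U : Submodule F V) :
    Submodule K E.Germs :=
  Submodule.span K {f | ∃ (d : ℕ) (u : Fin d → V), (∀ i, u i ∈ U) ∧ f = ∏ i, lin E (u i)}

/-- `R_Δ = Δ⁻¹ S(U)`, with `U` the span of `Δ`. -/
def ratSpace (E : FilteredLatticeSpace F V) (K : Subfield ℂ) (Δ : Finset V) :
    Submodule K E.Germs :=
  Submodule.span K {f | ∃ P ∈ symAlg E K (Submodule.span F (Δ : Set V)), ∃ n : V → ℕ,
    f = P / ∏ α ∈ Δ, lin E α ^ n α}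

/-- `R_Δ[j]`: the homogeneous part of `R_Δ` of total degree `j`. -/
def ratDeg (E : FilteredLatticeSpace F V) (K : Subfield ℂ) (Δ : Finset V) (j : ℤ) :
    Submodule K E.Germs :=
  Submodule.span K {f | ∃ (d : ℕ) (u : Fin d → V) (n : V → ℕ),
    (∀ i, u i ∈ Submodule.span F (Δ : Set V)) ∧ (d : ℤ) - ∑ α ∈ Δ, (n α : ℤ) = j ∧
    f = (∏ i, lin E (u i)) / ∏ α ∈ Δ, lin E α ^ n α}

/-- `G_Δ`: the span of the fractions `1 / ∏_{α ∈ κ} α ^ n_α` with `κ ⊆ Δ` generating and all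
`n_α > 0`. -/
def genSpace (E : FilteredLatticeSpace F V) (K : Subfield ℂ) (Δ : Finset V) :
    Submodule K E.Germs :=
  Submodule.span K {f | ∃ κ ⊆ Δ, ∃ n : V → ℕ,
    Submodule.span F (κ : Set V) = Submodule.span F (Δ : Set V) ∧ (∀ α ∈ κ, 0 < n α) ∧
    f = 1 / ∏ α ∈ κ, lin E α ^ n α}

/-- `NG_Δ`: the span of the fractions `h / ∏_{α ∈ κ} α ^ n_α` with `κ ⊆ Δ` not generating and
`h ∈ S(U)`. -/
def nonGenSpace (E : FilteredLatticeSpace F V) (K : Subfield ℂ) (Δ : Finset V) :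
    Submodule K E.Germs :=
  Submodule.span K {f | ∃ κ ⊆ Δ, ∃ n : V → ℕ,
    Submodule.span F (κ : Set V) ≠ Submodule.span F (Δ : Set V) ∧
    ∃ h ∈ symAlg E K (Submodule.span F (Δ : Set V)), f = h / ∏ α ∈ κ, lin E α ^ n α}

/-- `S_Δ`: the span of the fractions `1 / ∏_{α ∈ κ} α` with `κ ⊆ Δ` a basis of `span Δ`. -/
def simpleSpace (E : FilteredLatticeSpace F V) (K : Subfield ℂ) (Δ : Finset V) :
    Submodule K E.Germs :=
  Submodule.span K {f | ∃ κ ⊆ Δ, LinearIndepOn F id (κ : Set V) ∧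
    Submodule.span F (κ : Set V) = Submodule.span F (Δ : Set V) ∧
    f = 1 / ∏ α ∈ κ, lin E α}

/-- The dimension of the span of `Δ`. -/
def spanDim (F : Subfield ℝ) (Δ : Finset V) : ℕ :=
  Module.finrank F (Submodule.span F (Δ : Set V))

/-- The four summands of the Brion–Vergne decomposition
`R_Δ = R_Δ[> -r] ⊕ (NG_Δ ∩ R_Δ[≤ -r]) ⊕ G_Δ[< -r] ⊕ S_Δ`, in this order. -/
def jkSummand (E : FilteredLatticeSpace F V) (K : Subfield ℂ) (Δ : Finset V) :
    Fin 4 → Submodule K E.Germs :=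
  ![⨆ j ∈ {j : ℤ | -(spanDim F Δ : ℤ) < j}, ratDeg E K Δ j,
    nonGenSpace E K Δ ⊓ ⨆ j ∈ {j : ℤ | j ≤ -(spanDim F Δ : ℤ)}, ratDeg E K Δ j,
    genSpace E K Δ ⊓ ⨆ j ∈ {j : ℤ | j < -(spanDim F Δ : ℤ)}, ratDeg E K Δ j,
    simpleSpace E K Δ]

/-- The Jeffrey–Kirwan residue of `f ∈ R_Δ`: its component in the summand `S_Δ`. -/
def jkResidue (E : FilteredLatticeSpace F V) (K : Subfield ℂ) (Δ : Finset V) (f : E.Germs) :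
    E.Germs :=
  component (jkSummand E K Δ) 3 f

end LinearPoles

end

open Filter Topology

noncomputable section

namespace LinearPoles

variable {F : Subfield ℝ} {V : Type*} [AddCommGroup V] [Module ℝ V]

/-! ### Rationality and orthogonality in filtered lattice spaces -/

/-! Polar germs span by partial fractions. If the forms in a denominator are dependent, a linear
relation trades powers of one form for powers of another without changing the span of the forms or
the total order, until only bases of that span remain (`inv_dprod_mem_basicFractions`). Modulo the
forms of such a basis, a holomorphic numerator depends only on forms orthogonal to them
(`IsHolGerm.exists_orthogonal_add`). The orthogonal part gives a polar germ, and each remainder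
cancels a pole and has smaller order (`IsHolGerm.mul_inv_dprod_mem`).

Independence (`iSupIndep_polarSpace`) rests on `eventually_sum_fn_eq_zero`. In a vanishing sum
choose a maximal supporting subspace `U`, write a point as `y + u` with `y` zero on `U` and `u`
factoring through the orthogonal projection to `U`, and expand at `y + ε u` in powers of `ε`. A
polar germ supported on `U` of order `p` contributes only in degree `-p`. A germ with another
support contributes coefficients that are polynomial in `u` along some real covector `ξ` on `U`
vanishing on the part of its support inside `U`. The `U`-terms of order `p` tend to zero along every
such `ξ`, yet are a sum of functions each polynomial along one of them; finite differences then
force them to vanish.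

For the residue, fractions on generating sets have support `U = span Δ` and p-order equal to minus
their degree, so `S_Δ` lies in the polar space `(U, r)`. Cancelling numerators against denominators
(`ratDeg_le`) writes `R_Δ[j]` as non-generating fractions, whose supports are proper in `U`, plus
generating fractions of degree `j`. Hence the other three summands lie in the sum of the other polar
spaces (`jkSummand_le_otherPolar`), and projecting to `(U, r)` keeps exactly the `S_Δ` component.
The same inclusions, with the grading by degree (`iSupIndep_ratDeg`), make the four summands
independent. -/

lemma lattice_mono (E : FilteredLatticeSpace F V) : Monotone E.lattice :=
  monotone_nat_of_le_succ fun k v hv => ((E.lattice_compat k v).1 hv).1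

/-- The `F`-span of the `k`-th lattice. -/
def vectorsAt (E : FilteredLatticeSpace F V) (k : ℕ) : Submodule F V :=
  Submodule.span F (E.lattice k : Set V)

lemma vectorsAt_mono (E : FilteredLatticeSpace F V) : Monotone (vectorsAt E) :=
  fun _ _ h => Submodule.span_mono (lattice_mono E h)

lemma vectors_eq_iSup (E : FilteredLatticeSpace F V) : E.vectors = ⨆ k, vectorsAt E k :=
  Submodule.span_iUnion _

lemma vectorsAt_le (E : FilteredLatticeSpace F V) (k : ℕ) : vectorsAt E k ≤ E.vectors := by
  rw [vectors_eq_iSup]; exact le_iSup (vectorsAt E) k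

lemma mem_vectors_iff (E : FilteredLatticeSpace F V) {v : V} :
    v ∈ E.vectors ↔ ∃ k, v ∈ vectorsAt E k := by
  rw [vectors_eq_iSup, Submodule.mem_iSup_of_directed _ (vectorsAt_mono E).directed_le]

lemma exists_vectorsAt (E : FilteredLatticeSpace F V) (s : Finset V)
    (hs : ∀ v ∈ s, v ∈ E.vectors) : ∃ k, ∀ v ∈ s, v ∈ vectorsAt E k := by
  classical
  choose! f hf using fun v (hv : v ∈ s) => (mem_vectors_iff E).1 (hs v hv)
  exact ⟨s.sup f, fun v hv => vectorsAt_mono E (Finset.le_sup (f := f) hv) (hf v hv)⟩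

/-- The `F`-span of an `ℝ`-basis generating the `k`-th lattice. -/
lemma vectorsAt_eq_span (E : FilteredLatticeSpace F V) {k n : ℕ} {e : Fin n → V}
    (he : AddSubgroup.closure (Set.range e) = E.lattice k) :
    vectorsAt E k = Submodule.span F (Set.range e) := by
  refine le_antisymm (Submodule.span_le.2 ?_) (Submodule.span_mono ?_)
  · rw [← he]
    intro v hv
    have : AddSubgroup.closure (Set.range e) ≤
        (Submodule.span F (Set.range e)).toAddSubgroup :=
      (AddSubgroup.closure_le _).2 Submodule.subset_span
    exact this hv
  · rw [← he]
    exact AddSubgroup.subset_closure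

/-- Rationality passes from lattice vectors to their span by `F`-bilinearity. Both vectors are first
moved to a common level, since `Q_lattice` compares vectors of one lattice only. -/
lemma Q_mem (E : FilteredLatticeSpace F V) {u v : V} (hu : u ∈ E.vectors) (hv : v ∈ E.vectors) :
    E.Q u v ∈ F := by
  obtain ⟨k, hk⟩ := (mem_vectors_iff E).1 hu
  obtain ⟨l, hl⟩ := (mem_vectors_iff E).1 hv
  replace hk := vectorsAt_mono E (le_max_left k l) hk
  replace hl := vectorsAt_mono E (le_max_right k l) hl
  refine Submodule.span_induction₂ (p := fun u v _ _ => E.Q u v ∈ F) ?_ ?_ ?_ ?_ ?_ ?_ ?_ hk hl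
  · exact fun x y hx hy => E.Q_lattice _ x hx y hy
  · simp
  · simp
  · intro x y z _ _ _ h1 h2
    simpa using add_mem h1 h2
  · intro x y z _ _ _ h1 h2
    simpa using add_mem h1 h2
  · intro r x y _ _ h
    rw [Subfield.smul_def]
    simpa using mul_mem r.2 h
  · intro r x y _ _ h
    rw [Subfield.smul_def]
    simpa using mul_mem r.2 h

lemma span_F_le_span_R {s : Set V} {v : V} (hv : v ∈ Submodule.span F s) :
    v ∈ Submodule.span ℝ s :=
  Submodule.span_le_restrictScalars F ℝ s hv

/-- Orthogonal projection to the span of finitely many rational vectors; it is rational. -/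
lemma exists_orthogonal_projection (E : FilteredLatticeSpace F V) (s : Finset V)
    (hs : ∀ v ∈ s, v ∈ E.vectors) :
    ∃ π : V →ₗ[ℝ] V, (∀ v, π v ∈ Submodule.span ℝ (s : Set V)) ∧
      (∀ v ∈ E.vectors, π v ∈ Submodule.span F (s : Set V)) ∧
      ∀ v, ∀ u ∈ Submodule.span ℝ (s : Set V), E.Q (v - π v) u = 0 := by
  classical
  induction s using Finset.induction_on with
  | empty => exact ⟨0, by simp, by simp, by simp⟩
  | insert α s _ ih =>
    obtain ⟨π, h1, h2, h3⟩ := ih fun v hv => hs v (Finset.mem_insert_of_mem hv)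
    have hα := hs α (Finset.mem_insert_self _ _)
    have hsub : (s : Set V) ⊆ (insert α s : Finset V) := by
      rw [Finset.coe_insert]; exact Set.subset_insert _ _
    have hαR : α ∈ Submodule.span ℝ ((insert α s : Finset V) : Set V) :=
      Submodule.subset_span (by simp)
    have hαF : α ∈ Submodule.span F ((insert α s : Finset V) : Set V) :=
      Submodule.subset_span (by simp)
    set b := α - π α with hb
    have hbR : b ∈ Submodule.span ℝ ((insert α s : Finset V) : Set V) :=
      sub_mem hαR (Submodule.span_mono hsub (h1 α))
    have hbF : b ∈ Submodule.span F ((insert α s : Finset V) : Set V) :=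
      sub_mem hαF (Submodule.span_mono hsub (h2 α hα))
    have hle : Submodule.span F ((insert α s : Finset V) : Set V) ≤ E.vectors :=
      Submodule.span_le.2 hs
    have hbs : ∀ u ∈ Submodule.span ℝ (s : Set V), E.Q b u = 0 := h3 α
    have hbs' : ∀ u ∈ Submodule.span ℝ (s : Set V), E.Q u b = 0 := fun u hu => by
      rw [E.Q_symm]; exact hbs u hu
    -- A Gram–Schmidt step, `b` being the part of `α` orthogonal to the earlier vectors. If `b = 0`
    -- the added term vanishes by itself.
    refine ⟨π + (LinearMap.flip E.Q b).smulRight ((E.Q b b)⁻¹ • b), ?_, ?_, ?_⟩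
    · intro v
      exact add_mem (Submodule.span_mono hsub (h1 v))
        (Submodule.smul_mem _ _ (Submodule.smul_mem _ _ hbR))
    · intro v hv
      refine add_mem (Submodule.span_mono hsub (h2 v hv)) ?_
      have hc : E.Q v b * (E.Q b b)⁻¹ ∈ F :=
        mul_mem (Q_mem E hv (hle hbF)) (inv_mem (Q_mem E (hle hbF) (hle hbF)))
      have := Submodule.smul_mem _ (⟨_, hc⟩ : F) hbF
      rw [Subfield.smul_def] at this
      simpa [smul_smul] using this
    · intro v u hu
      have hbb : E.Q v b - E.Q v b * (E.Q b b)⁻¹ * E.Q b b = 0 := by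
        by_cases h : b = 0
        · simp [h]
        · have := (E.Q_pos b h).ne'
          field_simp
          ring
      have key : ∀ u ∈ Submodule.span ℝ (s : Set V),
          E.Q (v - (π + (LinearMap.flip E.Q b).smulRight ((E.Q b b)⁻¹ • b)) v) u = 0 := by
        intro u hu
        have := h3 v u hu
        simp only [map_sub, LinearMap.sub_apply] at this
        simp [hbs u hu, this]
      rw [Finset.coe_insert, Submodule.mem_span_insert] at hu
      obtain ⟨a, z, hz, rfl⟩ := hu
      have hαb : α = b + π α := by simp [hb]
      rw [map_add, map_smul, key z hz, hαb, map_add, key _ (h1 α)]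
      have h4 := hbs' _ (h1 v)
      have : E.Q (v - (π + (LinearMap.flip E.Q b).smulRight ((E.Q b b)⁻¹ • b)) v) b = 0 := by
        simp only [LinearMap.add_apply, map_sub, map_add, LinearMap.sub_apply, h4,
          LinearMap.smulRight_apply, map_smul, LinearMap.smul_apply, LinearMap.flip_apply,
          smul_eq_mul]
        linarith
      rw [this]
      simp

lemma eq_zero_of_Q_self (E : FilteredLatticeSpace F V) {v : V} (h : E.Q v v = 0) : v = 0 := by
  by_contra hv
  exact (E.Q_pos v hv).ne' h

/-- Rational vectors that are independent over `F` are independent over `ℝ`. -/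
lemma linearIndependent_real (E : FilteredLatticeSpace F V) {ι : Type*} {L : ι → V}
    (hL : ∀ i, L i ∈ E.vectors) (h : LinearIndependent F L) : LinearIndependent ℝ L := by
  classical
  rw [linearIndependent_iff']
  intro s c hc i hi
  -- Pairing the relation with the component of `L i` orthogonal to the other vectors isolates `c
  -- i`. That component is nonzero because the projection of `L i` lies in the `F`-span of the
  -- others.
  obtain ⟨π, -, h2, h3⟩ := exists_orthogonal_projection E ((s.erase i).image L) (by
    intro v hv
    obtain ⟨j, -, rfl⟩ := Finset.mem_image.1 hv
    exact hL j)
  have hb : L i - π (L i) ≠ 0 := by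
    intro h0
    have h4 := h2 (L i) (hL i)
    rw [← sub_eq_zero.1 h0, Finset.coe_image] at h4
    exact h.notMem_span_image (s := ((s.erase i : Finset ι) : Set ι)) (by simp) h4
  have h5 : E.Q (L i - π (L i)) (∑ j ∈ s, c j • L j) = c i * E.Q (L i - π (L i)) (L i) := by
    rw [map_sum, Finset.sum_eq_single i]
    · simp
    · intro j hj hji
      rw [map_smul, h3 _ _ (Submodule.subset_span (by
        simp only [Finset.coe_image]
        exact ⟨j, by simp [hj, hji], rfl⟩)), smul_zero]
    · exact fun h => absurd hi h
  rw [hc, map_zero] at h5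
  have h6 : E.Q (L i - π (L i)) (L i) = E.Q (L i - π (L i)) (L i - π (L i)) := by
    rw [map_sub (E.Q (L i - π (L i))), h3 (L i) (π (L i)) (span_F_le_span_R (h2 _ (hL i))),
      sub_zero]
  rw [h6] at h5
  rcases mul_eq_zero.1 h5.symm with h7 | h7
  · exact h7
  · exact absurd (eq_zero_of_Q_self E h7) hb

/-! ### Convergent power series with coefficients in a subfield -/

section PowerSeries
variable {ι κ : Type*} [Fintype ι] [Fintype κ] {K : Subfield ℂ}

/-- `IsHolomorphicAtZero` for functions of variables indexed by a finite type. -/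
def HolAt (K : Subfield ℂ) (h : (ι → ℂ) → ℂ) : Prop :=
  ∃ c : (ι → ℕ) → K, ∀ᶠ z in 𝓝 (0 : ι → ℂ),
    HasSum (fun a : ι → ℕ => (c a : ℂ) * ∏ i, z i ^ a i) (h z)

/-- Functions with a power series expansion at zero whose terms take values in `K` on vectors with
coordinates in `K`. -/
def HolSeries (K : Subfield ℂ) (h : (ι → ℂ) → ℂ) : Prop :=
  ∃ p : FormalMultilinearSeries ℂ (ι → ℂ) ℂ, HasFPowerSeriesAt h p 0 ∧
    ∀ (n : ℕ) (v : Fin n → ι → ℂ), (∀ j i, v j i ∈ K) → p n v ∈ K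

lemma hasSum_by_degree [DecidableEq ι] {f : (ι → ℕ) → ℂ} {x : ℂ} (h : HasSum f x) :
    HasSum (fun n => ∑ a ∈ Finset.piAntidiag Finset.univ n, f a) x := by
  have h1 := h.tsum_fiberwise (fun a => ∑ i, a i)
  have h2 : (fun n => ∑' b : ((fun a : ι → ℕ => ∑ i, a i) ⁻¹' {n} : Set (ι → ℕ)), f b) =
      fun n => ∑ a ∈ Finset.piAntidiag Finset.univ n, f a := by
    funext n
    rw [← Finset.tsum_subtype]
    have he : ∀ a : ι → ℕ, a ∈ (fun a : ι → ℕ => ∑ i, a i) ⁻¹' {n} ↔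
        a ∈ Finset.piAntidiag Finset.univ n := fun a => by simp
    exact Equiv.tsum_eq (Equiv.subtypeEquivRight he)
      (fun a : {a // a ∈ Finset.piAntidiag Finset.univ n} => f (a : ι → ℕ))
  rwa [h2] at h1

/-- Every finite set of multi-indices lies in finitely many degree layers, so for nonnegative terms
the layer sums bound all partial sums. -/
lemma summable_by_degree [DecidableEq ι] {f : (ι → ℕ) → ℝ} (hf : ∀ a, 0 ≤ f a)
    (h : Summable fun n => ∑ a ∈ Finset.piAntidiag Finset.univ n, f a) : Summable f := by
  refine summable_of_sum_le (c := ∑' n, ∑ a ∈ Finset.piAntidiag Finset.univ n, f a) hf ?_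
  intro u
  calc ∑ a ∈ u, f a
      ≤ ∑ a ∈ (u.image fun a => ∑ i, a i).biUnion (Finset.piAntidiag Finset.univ), f a := by
        refine Finset.sum_le_sum_of_subset_of_nonneg ?_ fun a _ _ => hf a
        intro a ha
        simp only [Finset.mem_biUnion, Finset.mem_image]
        exact ⟨_, ⟨a, ha, rfl⟩, by simp⟩
    _ = ∑ n ∈ u.image (fun a => ∑ i, a i), ∑ a ∈ Finset.piAntidiag Finset.univ n, f a := by
        refine Finset.sum_biUnion ?_
        intro m _ n _ hmn
        exact Finset.disjoint_left.2 fun a ha hb => hmn (by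
          simp only [Finset.mem_piAntidiag] at ha hb
          rw [← ha.1, ← hb.1])
    _ ≤ _ := h.sum_le_tsum _ fun n _ => Finset.sum_nonneg fun a _ => hf a

lemma norm_monomial_le {z : ι → ℂ} {ρ : ℝ} (hz : ∀ i, ‖z i‖ ≤ ρ) (a : ι → ℕ) :
    ‖∏ i, z i ^ a i‖ ≤ ρ ^ ∑ i, a i := by
  rw [norm_prod, ← Finset.prod_pow_eq_pow_sum]
  refine Finset.prod_le_prod (fun i _ => norm_nonneg _) fun i _ => ?_
  rw [norm_pow]
  exact pow_le_pow_left₀ (norm_nonneg _) (hz i) _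

/-- A power series that converges near zero converges absolutely on a polydisc. -/
lemma exists_summable_of_eventually_hasSum {c : (ι → ℕ) → ℂ} {h : (ι → ℂ) → ℂ}
    (hc : ∀ᶠ z in 𝓝 (0 : ι → ℂ), HasSum (fun a : ι → ℕ => c a * ∏ i, z i ^ a i) (h z)) :
    ∃ ρ : ℝ, 0 < ρ ∧ (Summable fun a => ‖c a‖ * ρ ^ ∑ i, a i) ∧
      ∀ z : ι → ℂ, (∀ i, ‖z i‖ ≤ ρ) →
        HasSum (fun a : ι → ℕ => c a * ∏ i, z i ^ a i) (h z) := by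
  obtain ⟨ε, hε, H⟩ := Metric.eventually_nhds_iff.1 hc
  have H' : ∀ z : ι → ℂ, (∀ i, ‖z i‖ ≤ ε / 2) →
        HasSum (fun a : ι → ℕ => c a * ∏ i, z i ^ a i) (h z) := by
    intro z hz
    refine H ?_
    rw [dist_zero_right]
    exact ((pi_norm_le_iff_of_nonneg (by positivity)).2 hz).trans_lt (half_lt_self hε)
  refine ⟨ε / 2, half_pos hε, ?_, H'⟩
  have h1 := (H' (fun _ => ((ε / 2 : ℝ) : ℂ)) (fun i => by
    rw [Complex.norm_real, Real.norm_of_nonneg (by positivity)])).summable.norm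
  refine h1.congr fun a => ?_
  rw [norm_mul, Finset.prod_pow_eq_pow_sum, norm_pow, Complex.norm_real,
    Real.norm_of_nonneg (by positivity)]

lemma summable_of_summable_norm {c : (ι → ℕ) → ℂ} {ρ : ℝ}
    (hc : Summable fun a => ‖c a‖ * ρ ^ ∑ i, a i) {z : ι → ℂ} (hz : ∀ i, ‖z i‖ ≤ ρ) :
    Summable fun a : ι → ℕ => c a * ∏ i, z i ^ a i :=
  Summable.of_norm_bounded hc fun a => by
    rw [norm_mul]
    exact mul_le_mul_of_nonneg_left (norm_monomial_le hz a) (norm_nonneg _)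

lemma eventually_norm_le {ρ : ℝ} (hρ : 0 < ρ) : ∀ᶠ z in 𝓝 (0 : ι → ℂ), ∀ i, ‖z i‖ ≤ ρ := by
  filter_upwards [Metric.ball_mem_nhds (0 : ι → ℂ) hρ] with z hz i
  exact (norm_le_pi_norm z i).trans (by simpa using (Metric.mem_ball.1 hz).le)

/-- Spelling a monomial of degree `n` as a word of length `n` makes it the diagonal of an `n`-linear
map. -/
lemma exists_word (a : ι → ℕ) :
    ∃ w : Fin (∑ i, a i) → ι, ∀ z : ι → ℂ, ∏ t, z (w t) = ∏ i, z i ^ a i := by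
  have e : Fin (∑ i, a i) ≃ Σ i, Fin (a i) :=
    (Fintype.equivFinOfCardEq (by simp)).symm
  refine ⟨fun t => (e t).1, fun z => ?_⟩
  rw [Equiv.prod_comp e (fun s => z s.1), Fintype.prod_sigma]
  simp

/-- The multilinear map `v ↦ ∏ v_t(w_t)`. -/
def wordMap {n : ℕ} (w : Fin n → ι) :
    ContinuousMultilinearMap ℂ (fun _ : Fin n => ι → ℂ) ℂ :=
  (ContinuousMultilinearMap.mkPiAlgebra ℂ (Fin n) ℂ).compContinuousLinearMap
    fun t => ContinuousLinearMap.proj (w t)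

lemma wordMap_apply {n : ℕ} (w : Fin n → ι) (v : Fin n → ι → ℂ) :
    wordMap w v = ∏ t, v t (w t) := by
  simp [wordMap]

lemma norm_wordMap_le {n : ℕ} (w : Fin n → ι) : ‖wordMap w‖ ≤ 1 := by
  refine ContinuousMultilinearMap.opNorm_le_bound zero_le_one fun v => ?_
  rw [wordMap_apply, one_mul, norm_prod]
  exact Finset.prod_le_prod (fun _ _ => norm_nonneg _) fun t _ => norm_le_pi_norm (v t) (w t)

/-- Each monomial is the diagonal of a multilinear map of norm at most one that preserves
`K`-rationality. Grouping by degree, absolute convergence on a polydisc bounds the radius from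
below. -/
lemma HolAt.holSeries {h : (ι → ℂ) → ℂ} (hh : HolAt K h) : HolSeries K h := by
  classical
  obtain ⟨c, hc⟩ := hh
  obtain ⟨ρ, hρ, hs, H⟩ := exists_summable_of_eventually_hasSum hc
  have hM : ∀ (n : ℕ) (a : ι → ℕ), ∃ M : ContinuousMultilinearMap ℂ (fun _ : Fin n => ι → ℂ) ℂ,
      ‖M‖ ≤ 1 ∧ (∀ v : Fin n → ι → ℂ, (∀ j i, v j i ∈ K) → M v ∈ K) ∧
      (∑ i, a i = n → ∀ z : ι → ℂ, M (fun _ => z) = ∏ i, z i ^ a i) := by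
    intro n a
    by_cases hn : ∑ i, a i = n
    · subst hn
      obtain ⟨w, hw⟩ := exists_word a
      refine ⟨wordMap w, norm_wordMap_le w, fun v hv => ?_, fun _ z => ?_⟩
      · rw [wordMap_apply]
        exact prod_mem fun t _ => hv t (w t)
      · rw [wordMap_apply, hw]
    · exact ⟨0, by simp, fun v _ => by simp, fun h => absurd h hn⟩
  choose M hM1 hMK hM using hM
  let p : FormalMultilinearSeries ℂ (ι → ℂ) ℂ := fun n =>
    ∑ a ∈ Finset.piAntidiag Finset.univ n, (c a : ℂ) • M n a
  have hp : ∀ n (z : ι → ℂ), p n (fun _ => z) =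
      ∑ a ∈ Finset.piAntidiag Finset.univ n, (c a : ℂ) * ∏ i, z i ^ a i := by
    intro n z
    simp only [p, _root_.sum_apply, _root_.smul_apply]
    refine Finset.sum_congr rfl fun a ha => ?_
    rw [hM n a (Finset.mem_piAntidiag.1 ha).1, smul_eq_mul]
  have hs' : Summable fun n => ‖p n‖ * ρ ^ n := by
    have h1 : Summable fun n => ∑ a ∈ Finset.piAntidiag Finset.univ n,
        ‖(c a : ℂ)‖ * ρ ^ ∑ i, a i := by
      have h2 := hs.hasSum
      have h3 := (Complex.hasSum_ofReal.2 h2)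
      have h4 := (hasSum_by_degree h3).summable
      rw [← Complex.summable_ofReal]
      exact h4.congr fun n => by push_cast; rfl
    refine Summable.of_nonneg_of_le (fun n => by positivity) (fun n => ?_) h1
    calc ‖p n‖ * ρ ^ n ≤ (∑ a ∈ Finset.piAntidiag Finset.univ n, ‖(c a : ℂ)‖) * ρ ^ n := by
          gcongr
          refine (norm_sum_le _ _).trans (Finset.sum_le_sum fun a _ => ?_)
          rw [norm_smul]
          exact mul_le_of_le_one_right (norm_nonneg _) (hM1 n a)
      _ = _ := by
          rw [Finset.sum_mul]
          refine Finset.sum_congr rfl fun a ha => ?_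
          rw [(Finset.mem_piAntidiag.1 ha).1]
  lift ρ to NNReal using hρ.le
  refine ⟨p, ⟨ρ, ⟨p.le_radius_of_summable_norm hs', by exact_mod_cast hρ, fun {z} hz => ?_⟩⟩, ?_⟩
  · rw [zero_add]
    have hz' : ∀ i, ‖z i‖ ≤ ρ := by
      intro i
      rw [mem_eball_zero_iff] at hz
      refine (norm_le_pi_norm z i).trans ?_
      have := ENNReal.toReal_mono (by simp) hz.le
      simpa using this
    have := hasSum_by_degree (H z hz')
    simpa only [hp] using this
  · intro n v hv
    simp only [p, _root_.sum_apply, _root_.smul_apply]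
    exact sum_mem fun a _ => mul_mem (c a).2 (hMK n a v hv)

/-- Expanding the diagonal of `p n` on the standard basis, the coefficient of `z ^ a` is the sum of
the values of `p n` over all words with letter counts `a`. -/
lemma HolSeries.holAt {h : (ι → ℂ) → ℂ} (hh : HolSeries K h) : HolAt K h := by
  classical
  obtain ⟨p, ⟨r, hp⟩, hK⟩ := hh
  let e : ι → ι → ℂ := fun i => Pi.single i 1
  let cnt : (n : ℕ) → (Fin n → ι) → ι → ℕ := fun n w i => (Finset.univ.filter fun t => w t = i).card
  let d : (n : ℕ) → (ι → ℕ) → ℂ := fun n a =>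
    ∑ w ∈ Finset.univ.filter (fun w : Fin n → ι => cnt n w = a), p n (fun t => e (w t))
  have hcnt : ∀ n (w : Fin n → ι), ∑ i, cnt n w i = n := by
    intro n w
    have := Finset.card_eq_sum_card_fiberwise (f := w) (s := Finset.univ) (t := Finset.univ)
      (by simp)
    simpa using this.symm
  have hmon : ∀ n (w : Fin n → ι) (z : ι → ℂ), ∏ t, z (w t) = ∏ i, z i ^ cnt n w i := by
    intro n w z
    rw [← Finset.prod_fiberwise (s := Finset.univ) (g := w)]
    refine Finset.prod_congr rfl fun i _ => ?_
    rw [Finset.prod_congr rfl (g := fun _ => z i) (fun t ht => by rw [(Finset.mem_filter.1 ht).2]),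
      Finset.prod_const]
  have hz : ∀ z : ι → ℂ, z = ∑ i, z i • e i := fun z => by
    ext j
    simp [e, Finset.sum_apply, Pi.single_apply]
  have hexp : ∀ n (z : ι → ℂ), p n (fun _ => z) =
      ∑ a ∈ Finset.piAntidiag Finset.univ n, d n a * ∏ i, z i ^ a i := by
    intro n z
    conv_lhs => rw [hz z]
    rw [ContinuousMultilinearMap.map_sum]
    rw [← Finset.sum_fiberwise_of_maps_to (s := Finset.univ)
      (t := Finset.piAntidiag Finset.univ n) (g := cnt n) (by
        intro w _; simp [hcnt])]
    refine Finset.sum_congr rfl fun a _ => ?_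
    rw [Finset.sum_mul]
    refine Finset.sum_congr rfl fun w hw => ?_
    rw [ContinuousMultilinearMap.map_smul_univ, hmon, (Finset.mem_filter.1 hw).2, smul_eq_mul,
      mul_comm]
  have hdK : ∀ n a, d n a ∈ K := fun n a => sum_mem fun w _ => hK n _ fun t i => by
    simp only [e, Pi.single_apply]
    split_ifs <;> simp
  have hdn : ∀ n, ∑ a ∈ Finset.piAntidiag Finset.univ n, ‖d n a‖ ≤
      (Fintype.card ι : ℝ) ^ n * ‖p n‖ := by
    intro n
    calc _ ≤ ∑ a ∈ Finset.piAntidiag Finset.univ n,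
          ∑ w ∈ Finset.univ.filter (fun w : Fin n → ι => cnt n w = a), ‖p n‖ := by
          refine Finset.sum_le_sum fun a _ => (norm_sum_le _ _).trans ?_
          refine Finset.sum_le_sum fun w _ => ?_
          refine (ContinuousMultilinearMap.le_opNorm _ _).trans ?_
          rw [Finset.prod_eq_one fun t _ => by simp only [e, Pi.norm_single, norm_one], mul_one]
      _ = ∑ w : Fin n → ι, ‖p n‖ :=
          Finset.sum_fiberwise_of_maps_to (s := Finset.univ) (g := cnt n) (by
            intro w _; simp [hcnt]) _
      _ = _ := by simp
  obtain ⟨R, hR0, hR⟩ : ∃ R : NNReal, 0 < R ∧ (R : ENNReal) < r :=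
    ENNReal.lt_iff_exists_nnreal_btwn.1 hp.r_pos |>.imp fun R hR => ⟨by exact_mod_cast hR.1, hR.2⟩
  have hsum := p.summable_norm_mul_pow (hR.trans_le hp.r_le)
  -- There are `card ι ^ n` words of length `n`; shrinking the radius absorbs this factor. The `+ 1`
  -- also covers empty `ι` and gives `ρ ≤ R`.
  set ρ : ℝ := R / (Fintype.card ι + 1) with hρ
  have hρ0 : 0 < ρ := by positivity
  have hρR : Fintype.card ι * ρ ≤ R := by
    rw [hρ, mul_div_assoc', div_le_iff₀ (by positivity)]
    nlinarith [R.coe_nonneg]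
  have hρR' : ρ ≤ R := by
    rw [hρ, div_le_iff₀ (by positivity)]
    have : (0 : ℝ) ≤ Fintype.card ι := Nat.cast_nonneg _
    nlinarith [R.coe_nonneg]
  have hsummable : Summable fun a : ι → ℕ => ‖d (∑ i, a i) a‖ * ρ ^ ∑ i, a i := by
    refine summable_by_degree (fun a => by positivity) ?_
    refine Summable.of_nonneg_of_le (fun n => Finset.sum_nonneg fun a _ => by positivity) ?_ hsum
    intro n
    calc _ = ∑ a ∈ Finset.piAntidiag Finset.univ n, ‖d n a‖ * ρ ^ n := by
          refine Finset.sum_congr rfl fun a ha => ?_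
          rw [(Finset.mem_piAntidiag.1 ha).1]
      _ ≤ (Fintype.card ι : ℝ) ^ n * ‖p n‖ * ρ ^ n := by
          rw [← Finset.sum_mul]
          exact mul_le_mul_of_nonneg_right (hdn n) (by positivity)
      _ = ‖p n‖ * (Fintype.card ι * ρ) ^ n := by rw [mul_pow]; ring
      _ ≤ ‖p n‖ * (R : ℝ) ^ n := by gcongr
  refine ⟨fun a => ⟨d (∑ i, a i) a, hdK _ _⟩, ?_⟩
  filter_upwards [eventually_norm_le (ι := ι) (half_pos hρ0)] with z hz
  have h1 := (summable_of_summable_norm hsummable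
    fun i => (hz i).trans (half_le_self hρ0.le)).hasSum
  have h2 := hasSum_by_degree h1
  have h3 : HasSum (fun n => p n fun _ => z) (h (0 + z)) := by
    refine hp.hasSum ?_
    rw [mem_eball_zero_iff]
    refine lt_of_le_of_lt ?_ hR
    rw [← ofReal_norm, ENNReal.ofReal_le_iff_le_toReal (by simp)]
    exact (((pi_norm_le_iff_of_nonneg (by positivity)).2 hz).trans (half_le_self hρ0.le)).trans hρR'
  rw [zero_add] at h3
  have h4 := h2.unique (a₂ := h z) (by
    convert h3 using 2 with n
    rw [hexp]
    refine Finset.sum_congr rfl fun a ha => ?_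
    rw [(Finset.mem_piAntidiag.1 ha).1])
  rw [← h4]
  exact h1

lemma HolAt.analyticAt {h : (ι → ℂ) → ℂ} (hh : HolAt K h) : AnalyticAt ℂ h 0 :=
  let ⟨p, hp, _⟩ := hh.holSeries
  ⟨p, hp⟩

lemma HolAt.add {g h : (ι → ℂ) → ℂ} (hg : HolAt K g) (hh : HolAt K h) :
    HolAt K fun z => g z + h z := by
  obtain ⟨c, hc⟩ := hg
  obtain ⟨d, hd⟩ := hh
  refine ⟨c + d, ?_⟩
  filter_upwards [hc, hd] with z h1 h2
  simpa [add_mul] using h1.add h2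

lemma HolAt.const_mul {h : (ι → ℂ) → ℂ} (k : K) (hh : HolAt K h) :
    HolAt K fun z => (k : ℂ) * h z := by
  obtain ⟨c, hc⟩ := hh
  refine ⟨fun a => k * c a, ?_⟩
  filter_upwards [hc] with z h1
  simpa [mul_assoc] using h1.mul_left (k : ℂ)

lemma holAt_const (k : K) : HolAt K fun _ : ι → ℂ => (k : ℂ) := by
  classical
  refine ⟨Pi.single 0 k, Eventually.of_forall fun z => ?_⟩
  convert hasSum_single (0 : ι → ℕ) ?_ using 1
  · simp
  · intro a ha
    simp [ha]

/-- Substitution of linear forms with coefficients in `K`. -/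
lemma HolAt.comp_linear {h : (ι → ℂ) → ℂ} (hh : HolAt K h) (A : ι → κ → K) :
    HolAt K fun z : κ → ℂ => h fun i => ∑ j, (A i j : ℂ) * z j := by
  obtain ⟨p, hp, hK⟩ := hh.holSeries
  let u : (κ → ℂ) →L[ℂ] (ι → ℂ) := ContinuousLinearMap.pi fun i =>
    ∑ j, (A i j : ℂ) • ContinuousLinearMap.proj j
  have hu : ∀ z i, u z i = ∑ j, (A i j : ℂ) * z j := fun z i => by simp [u]
  have h1 : HasFPowerSeriesAt (h ∘ u) (p.compContinuousLinearMap u) 0 :=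
    HasFPowerSeriesAt.compContinuousLinearMap (by simpa using hp)
  refine HolSeries.holAt ⟨p.compContinuousLinearMap u, ?_, fun n v hv => ?_⟩
  · convert h1 using 1
    funext z
    simp only [Function.comp]
    congr 1
    funext i
    exact (hu z i).symm
  · refine hK n _ fun t i => ?_
    change u (v t) i ∈ K
    rw [hu]
    exact sum_mem fun j _ => mul_mem (A i j).2 (hv t j)

lemma monomial_add_single [DecidableEq ι] (z : ι → ℂ) (a : ι → ℕ) (i : ι) :
    ∏ j, z j ^ (a + Pi.single i 1 : ι → ℕ) j = z i * ∏ j, z j ^ a j := by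
  simp only [Pi.add_apply, pow_add, Finset.prod_mul_distrib]
  rw [Finset.prod_eq_single (f := fun x => z x ^ (Pi.single i 1 : ι → ℕ) x) i]
  · simp [mul_comm]
  · intro j _ hj; simp [hj]
  · simp

lemma exists_add_single [DecidableEq ι] {a : ι → ℕ} {i : ι} (h : a i ≠ 0) :
    ∃ b : ι → ℕ, b + Pi.single i 1 = a := by
  refine ⟨a - Pi.single i 1, ?_⟩
  funext j
  by_cases hj : j = i
  · subst hj; simp; omega
  · simp [hj]

/-- Multiplication by a coordinate. -/
lemma HolAt.coord_mul {h : (ι → ℂ) → ℂ} (hh : HolAt K h) (i : ι) :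
    HolAt K fun z => z i * h z := by
  classical
  obtain ⟨c, hc⟩ := hh
  have hinj : Function.Injective fun a : ι → ℕ => a + Pi.single i 1 := add_left_injective _
  refine ⟨fun a => if a i = 0 then 0 else c (a - Pi.single i 1), ?_⟩
  filter_upwards [hc] with z h1
  refine (hinj.hasSum_iff (fun a ha => ?_)).1 ?_
  · have : a i = 0 := by
      by_contra h0
      exact ha (exists_add_single h0)
    simp [this]
  · have h2 := h1.mul_left (z i)
    refine Eq.subst (motive := fun f => HasSum f (z i * h z)) (funext fun a => ?_) h2
    simp only [Function.comp, monomial_add_single]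
    simp
    ring

/-- Division by a coordinate with remainder. -/
lemma HolAt.exists_div_coord [DecidableEq ι] {h : (ι → ℂ) → ℂ} (hh : HolAt K h) (i : ι) :
    ∃ g : (ι → ℂ) → ℂ, HolAt K g ∧
      ∀ᶠ z in 𝓝 (0 : ι → ℂ), h z = h (Function.update z i 0) + z i * g z := by
  obtain ⟨c, hc⟩ := hh
  obtain ⟨ρ, hρ, hs, H⟩ := exists_summable_of_eventually_hasSum hc
  have hinj : Function.Injective fun a : ι → ℕ => a + Pi.single i 1 := add_left_injective _
  have hdeg : ∀ a : ι → ℕ, ∑ j, (a + Pi.single i 1 : ι → ℕ) j = ∑ j, a j + 1 := fun a => by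
    simp [Finset.sum_add_distrib]
  have hs' : Summable fun a : ι → ℕ => ‖(c (a + Pi.single i 1) : ℂ)‖ * ρ ^ ∑ j, a j := by
    refine ((hs.comp_injective hinj).mul_right ρ⁻¹).congr fun a => ?_
    simp only [Function.comp, hdeg, pow_succ]
    field_simp
  refine ⟨fun z => ∑' a : ι → ℕ, (c (a + Pi.single i 1) : ℂ) * ∏ j, z j ^ a j,
    ⟨fun a => c (a + Pi.single i 1), ?_⟩, ?_⟩
  · filter_upwards [eventually_norm_le hρ] with z hz
    exact (summable_of_summable_norm hs' hz).hasSum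
  · filter_upwards [eventually_norm_le hρ] with z hz
    have h1 := H z hz
    have h0 := H (Function.update z i 0) (fun j => by
      by_cases hj : j = i
      · subst hj; simpa using hρ.le
      · simpa [hj] using hz j)
    have h2 := ((summable_of_summable_norm hs' hz).hasSum.mul_left (z i))
    have h3 := h1.sub h0
    -- Monomials free of `z i` cancel in `h z - h (Function.update z i 0)`, so only the shifted
    -- multi-indices contribute.
    rw [← hinj.hasSum_iff] at h3
    · have h4 := h2.unique (a₂ := h z - h (Function.update z i 0)) (by
        refine Eq.subst (motive := fun f => HasSum f (h z - h (Function.update z i 0)))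
          (funext fun a => ?_) h3
        simp only [Function.comp, monomial_add_single, Function.update_self]
        ring)
      rw [h4]
      ring
    · intro a ha
      have hai : a i = 0 := by
        by_contra h0
        exact ha (exists_add_single h0)
      rw [sub_eq_zero]
      congr 1
      refine Finset.prod_congr rfl fun j _ => ?_
      by_cases hj : j = i
      · subst hj; simp [hai]
      · simp [hj]

end PowerSeries

/-! ### The ring of germs -/

section Germs
variable {E : FilteredLatticeSpace F V} {K : Subfield ℂ}

instance : IsScalarTower K E.Germs E.Germs where
  smul_assoc k f g := by
    induction f using Filter.Germ.inductionOn with | _ f =>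
    induction g using Filter.Germ.inductionOn with | _ g =>
    exact congrArg (fun h : (V →ₗ[ℝ] ℂ) → ℂ => (h : E.Germs)) (smul_assoc k f g)

instance : SMulCommClass K E.Germs E.Germs where
  smul_comm k f g := by
    induction f using Filter.Germ.inductionOn with | _ f =>
    induction g using Filter.Germ.inductionOn with | _ g =>
    exact congrArg (fun h : (V →ₗ[ℝ] ℂ) → ℂ => (h : E.Germs)) (smul_comm k f g)

/-- The ring of germs need not be a field, but pointwise inversion still satisfies laws such as
`mul_inv`; actual cancellation is supplied by `lin_mul_inv`. -/
instance : DivisionCommMonoid E.Germs where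
  mul_comm := mul_comm

lemma tendsto_offPoles {ι : Type*} (E : FilteredLatticeSpace F V) (ℓ : ι → V) :
    Tendsto (fun (x : V →ₗ[ℝ] ℂ) i => x (ℓ i)) E.offPoles (𝓝 (0 : ι → ℂ)) := by
  have h : Tendsto (fun (x : V →ₗ[ℝ] ℂ) (v : V) => x v) E.offPoles (𝓝 (0 : V → ℂ)) :=
    tendsto_comap.mono_left inf_le_left
  rw [tendsto_pi_nhds] at h ⊢
  exact fun i => h (ℓ i)

lemma eventually_apply_ne_zero {L : V} (hL : L ∈ E.vectors) (h0 : L ≠ 0) :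
    ∀ᶠ x : V →ₗ[ℝ] ℂ in E.offPoles, x L ≠ 0 := by
  have h1 : (⨅ L ∈ {L : V | L ∈ E.vectors ∧ L ≠ 0}, 𝓟 {x : V →ₗ[ℝ] ℂ | x L ≠ 0}) ≤
      𝓟 {x : V →ₗ[ℝ] ℂ | x L ≠ 0} := iInf₂_le L ⟨hL, h0⟩
  exact (inf_le_right.trans h1) (mem_principal_self _)

/-- A property that holds off poles near zero holds for all points small on finitely many vectors
and nonzero on finitely many others. -/
lemma exists_of_eventually_offPoles {P : (V →ₗ[ℝ] ℂ) → Prop} (h : ∀ᶠ x in E.offPoles, P x) :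
    ∃ (s T : Finset V) (δ : ℝ), 0 < δ ∧ (∀ L ∈ T, L ∈ E.vectors ∧ L ≠ 0) ∧
      ∀ x : V →ₗ[ℝ] ℂ, (∀ v ∈ s, ‖x v‖ < δ) → (∀ L ∈ T, x L ≠ 0) → P x := by
  classical
  -- The sets with the required description form a filter, so it is enough to compare it with the
  -- generators of `E.offPoles`.
  let G : Filter (V →ₗ[ℝ] ℂ) :=
    { sets := {A | ∃ (s T : Finset V) (δ : ℝ), 0 < δ ∧ (∀ L ∈ T, L ∈ E.vectors ∧ L ≠ 0) ∧
        ∀ x : V →ₗ[ℝ] ℂ, (∀ v ∈ s, ‖x v‖ < δ) → (∀ L ∈ T, x L ≠ 0) → x ∈ A}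
      univ_sets := ⟨∅, ∅, 1, one_pos, by simp, by simp⟩
      sets_of_superset := by
        rintro A B ⟨s, T, δ, h1, h2, h3⟩ hAB
        exact ⟨s, T, δ, h1, h2, fun x hx hx' => hAB (h3 x hx hx')⟩
      inter_sets := by
        rintro A B ⟨s, T, δ, h1, h2, h3⟩ ⟨s', T', δ', h1', h2', h3'⟩
        refine ⟨s ∪ s', T ∪ T', min δ δ', lt_min h1 h1', ?_, ?_⟩
        · intro L hL
          rcases Finset.mem_union.1 hL with hL | hL
          exacts [h2 L hL, h2' L hL]
        · intro x hx hx'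
          exact ⟨h3 x (fun v hv => (hx v (Finset.mem_union_left _ hv)).trans_le (min_le_left _ _))
            fun L hL => hx' L (Finset.mem_union_left _ hL),
            h3' x (fun v hv => (hx v (Finset.mem_union_right _ hv)).trans_le (min_le_right _ _))
            fun L hL => hx' L (Finset.mem_union_right _ hL)⟩ }
  have hG : G ≤ E.offPoles := by
    refine le_inf ?_ (le_iInf₂ fun L hL => ?_)
    · rw [← tendsto_iff_comap, tendsto_pi_nhds]
      intro v
      refine Metric.tendsto_nhds.2 fun δ hδ => ?_
      exact ⟨{v}, ∅, δ, hδ, by simp, fun x hx _ => by simpa using hx v (by simp)⟩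
    · refine le_principal_iff.2 ?_
      exact ⟨∅, {L}, 1, one_pos, fun L' hL' => by rw [Finset.mem_singleton.1 hL']; exact hL,
        fun x _ hx => hx L (by simp)⟩
  exact hG h

lemma lin_add (u v : V) : lin E (u + v) = lin E u + lin E v := by
  simp only [lin, map_add]; rfl

lemma lin_zero : lin E 0 = 0 := by
  simp only [lin, map_zero]; rfl

lemma lin_smul (hFK : ∀ a ∈ F, ((a : ℝ) : ℂ) ∈ K) (c : F) (v : V) :
    lin E (c • v) = (⟨((c : ℝ) : ℂ), hFK c c.2⟩ : K) • lin E v := by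
  have h : ∀ x : V →ₗ[ℝ] ℂ, x (c • v) = (⟨((c : ℝ) : ℂ), hFK c c.2⟩ : K) • x v := by
    intro x
    rw [Subfield.smul_def, Subfield.smul_def, map_smul, Complex.real_smul, smul_eq_mul]
  simp only [lin, h]; rfl

lemma lin_sum {ι : Type*} (s : Finset ι) (v : ι → V) :
    lin E (∑ i ∈ s, v i) = ∑ i ∈ s, lin E (v i) := by
  classical
  induction s using Finset.induction_on with
  | empty => simp [lin_zero]
  | insert i s hi ih => rw [Finset.sum_insert hi, Finset.sum_insert hi, lin_add, ih]

lemma lin_mul_inv {v : V} (hv : v ∈ E.vectors) (h0 : v ≠ 0) : lin E v * (lin E v)⁻¹ = 1 := by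
  refine Filter.Germ.coe_eq.2 ?_
  filter_upwards [eventually_apply_ne_zero hv h0] with x hx
  exact mul_inv_cancel₀ hx

/-- The germ of a function of finitely many linear forms. -/
def genGerm (E : FilteredLatticeSpace F V) {ι : Type*} (h : (ι → ℂ) → ℂ) (ℓ : ι → V) : E.Germs :=
  ((fun x : V →ₗ[ℝ] ℂ => h (fun i => x (ℓ i)) : (V →ₗ[ℝ] ℂ) → ℂ) : E.Germs)

lemma germOf_eq_genGerm {m : ℕ} (h : (Fin m → ℂ) → ℂ) (ℓ : Fin m → V) :
    germOf E h ℓ = genGerm E h ℓ := rfl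

lemma genGerm_congr {ι : Type*} {h g : (ι → ℂ) → ℂ} (ℓ : ι → V)
    (hhg : ∀ᶠ z in 𝓝 (0 : ι → ℂ), h z = g z) : genGerm E h ℓ = genGerm E g ℓ :=
  Filter.Germ.coe_eq.2 ((tendsto_offPoles E ℓ).eventually hhg)

/-- Change of coordinates: a holomorphic germ in linear forms from the span of a finite family is a
holomorphic germ in that family. -/
lemma exists_genGerm_of_mem_span (hFK : ∀ a ∈ F, ((a : ℝ) : ℂ) ∈ K) {ι κ : Type*} [Fintype ι]
    [Fintype κ] {h : (ι → ℂ) → ℂ} (hh : HolAt K h) {ℓ : ι → V} {e : κ → V}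
    (he : ∀ i, ℓ i ∈ Submodule.span F (Set.range e)) :
    ∃ g : (κ → ℂ) → ℂ, HolAt K g ∧ genGerm E h ℓ = genGerm E g e := by
  choose A hA using fun i => (Submodule.mem_span_range_iff_exists_fun F).1 (he i)
  refine ⟨_, hh.comp_linear fun i j => ⟨((A i j : ℝ) : ℂ), hFK _ (A i j).2⟩, ?_⟩
  have : ∀ (x : V →ₗ[ℝ] ℂ) i, x (ℓ i) = ∑ j, ((A i j : ℝ) : ℂ) * x (e j) := by
    intro x i
    rw [← hA i, map_sum]
    refine Finset.sum_congr rfl fun j _ => ?_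
    rw [Subfield.smul_def, map_smul, Complex.real_smul]
  simp only [genGerm, this]

/-- The holomorphic germs in rational linear forms with coefficients in `K`. -/
def IsHolGerm (E : FilteredLatticeSpace F V) (K : Subfield ℂ) (g : E.Germs) : Prop :=
  ∃ (m : ℕ) (ℓ : Fin m → V) (h : (Fin m → ℂ) → ℂ),
    (∀ i, ℓ i ∈ E.vectors) ∧ HolAt K h ∧ g = genGerm E h ℓ

lemma isHolGerm_genGerm (hFK : ∀ a ∈ F, ((a : ℝ) : ℂ) ∈ K) {ι : Type*} [Fintype ι]
    {h : (ι → ℂ) → ℂ} (hh : HolAt K h) {ℓ : ι → V} (hℓ : ∀ i, ℓ i ∈ E.vectors) :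
    IsHolGerm E K (genGerm E h ℓ) := by
  obtain ⟨g, hg, h1⟩ := exists_genGerm_of_mem_span (E := E) hFK hh
    (e := ℓ ∘ (Fintype.equivFin ι).symm) (ℓ := ℓ) fun i =>
      Submodule.subset_span ⟨Fintype.equivFin ι i, by simp⟩
  exact ⟨_, _, g, fun i => hℓ _, hg, h1⟩

/-- Since `IsHolGerm` asks for no independence of the forms, both germs can be rewritten in the
concatenated family and added there. -/
lemma IsHolGerm.add (hFK : ∀ a ∈ F, ((a : ℝ) : ℂ) ∈ K) {f g : E.Germs} (hf : IsHolGerm E K f)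
    (hg : IsHolGerm E K g) : IsHolGerm E K (f + g) := by
  obtain ⟨m, ℓ, h, hℓ, hh, rfl⟩ := hf
  obtain ⟨m', ℓ', h', hℓ', hh', rfl⟩ := hg
  obtain ⟨p, hp, h1⟩ := exists_genGerm_of_mem_span (E := E) hFK hh (ℓ := ℓ)
    (e := Sum.elim ℓ ℓ') fun i => Submodule.subset_span ⟨Sum.inl i, rfl⟩
  obtain ⟨q, hq, h2⟩ := exists_genGerm_of_mem_span (E := E) hFK hh' (ℓ := ℓ')
    (e := Sum.elim ℓ ℓ') fun i => Submodule.subset_span ⟨Sum.inr i, rfl⟩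
  rw [h1, h2]
  exact isHolGerm_genGerm hFK (hp.add hq) (by rintro (i | i); exacts [hℓ i, hℓ' i])

lemma IsHolGerm.lin_mul (hFK : ∀ a ∈ F, ((a : ℝ) : ℂ) ∈ K) {f : E.Germs} (hf : IsHolGerm E K f)
    {v : V} (hv : v ∈ E.vectors) : IsHolGerm E K (lin E v * f) := by
  obtain ⟨m, ℓ, h, hℓ, hh, rfl⟩ := hf
  obtain ⟨p, hp, h1⟩ := exists_genGerm_of_mem_span (E := E) hFK hh (ℓ := ℓ)
    (e := Sum.elim (fun _ : Unit => v) ℓ) fun i => Submodule.subset_span ⟨Sum.inr i, rfl⟩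
  rw [h1]
  exact isHolGerm_genGerm hFK (hp.coord_mul (Sum.inl ())) (ℓ := Sum.elim (fun _ : Unit => v) ℓ)
    (by rintro (i | i); exacts [hv, hℓ i])

lemma IsHolGerm.smul {f : E.Germs} (hf : IsHolGerm E K f) (k : K) : IsHolGerm E K (k • f) := by
  obtain ⟨m, ℓ, h, hℓ, hh, rfl⟩ := hf
  exact ⟨m, ℓ, _, hℓ, hh.const_mul k, rfl⟩

lemma isHolGerm_one : IsHolGerm E K (1 : E.Germs) :=
  ⟨0, Fin.elim0, _, fun i => i.elim0, holAt_const 1, rfl⟩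

lemma isHolGerm_zero : IsHolGerm E K (0 : E.Germs) :=
  ⟨0, Fin.elim0, _, fun i => i.elim0, holAt_const 0, rfl⟩

lemma IsHolGerm.prod_lin_mul (hFK : ∀ a ∈ F, ((a : ℝ) : ℂ) ∈ K) {f : E.Germs}
    (hf : IsHolGerm E K f) {ι : Type*} (s : Finset ι) {v : ι → V}
    (hv : ∀ i ∈ s, v i ∈ E.vectors) : IsHolGerm E K ((∏ i ∈ s, lin E (v i)) * f) := by
  classical
  induction s using Finset.induction_on with
  | empty => simpa using hf
  | insert i s hi ih =>
    rw [Finset.prod_insert hi, mul_assoc]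
    exact (ih fun j hj => hv j (Finset.mem_insert_of_mem hj)).lin_mul hFK
      (hv i (Finset.mem_insert_self _ _))

/-- Finitely many rational vectors lie in the `F`-span of a single lattice, so a `K`-rational change
of coordinates passes to a basis of that lattice. The level `k` can then be forgotten. -/
lemma isHolGerm_iff (hFK : ∀ a ∈ F, ((a : ℝ) : ℂ) ∈ K) {g : E.Germs} :
    IsHolomorphicGerm E K g ↔ IsHolGerm E K g := by
  classical
  constructor
  · rintro ⟨k, n, e, h, -, -, he, hh, rfl⟩
    refine ⟨n, e, h, fun i => vectorsAt_le E k ?_, hh, rfl⟩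
    rw [vectorsAt_eq_span E he]
    exact Submodule.subset_span ⟨i, rfl⟩
  · rintro ⟨m, ℓ, h, hℓ, hh, rfl⟩
    obtain ⟨k, hk⟩ := exists_vectorsAt E (Finset.univ.image ℓ) (by simpa using hℓ)
    obtain ⟨n, e, he1, he2, he3⟩ := E.lattice_basis k
    rw [vectorsAt_eq_span E he3] at hk
    obtain ⟨p, hp, h1⟩ := exists_genGerm_of_mem_span (E := E) hFK hh (ℓ := ℓ) (e := e)
      fun i => hk _ (by simp)
    exact ⟨k, n, e, p, he1, he2, he3, hp, h1⟩

/-- Taylor expansion with remainder along a set of variables. -/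
lemma exists_genGerm_div (hFK : ∀ a ∈ F, ((a : ℝ) : ℂ) ∈ K) {ι : Type*} [Fintype ι]
    [DecidableEq ι] {h : (ι → ℂ) → ℂ} (hh : HolAt K h) {ℓ : ι → V} (hℓ : ∀ i, ℓ i ∈ E.vectors)
    (s : Finset ι) : ∃ g : ι → E.Germs, (∀ i, IsHolGerm E K (g i)) ∧
      genGerm E h ℓ = genGerm E (fun z => h fun i => if i ∈ s then 0 else z i) ℓ +
        ∑ i ∈ s, lin E (ℓ i) * g i := by
  induction s using Finset.induction_on with
  | empty => exact ⟨0, fun _ => isHolGerm_zero, by simp⟩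
  | insert j s hj ih =>
    obtain ⟨g, hg, h1⟩ := ih
    have h0 : HolAt K fun z : ι → ℂ => h fun i => if i ∈ s then 0 else z i := by
      refine Eq.subst (motive := HolAt K) (funext fun z => congrArg h (funext fun i => ?_))
        (hh.comp_linear (fun i k => if i ∈ s then (0 : K) else if i = k then 1 else 0))
      by_cases hi : i ∈ s
      · simp [hi]
      · simp only [hi, if_false]
        rw [Finset.sum_eq_single i] <;> simp +contextual [eq_comm]
    obtain ⟨q, hq, h2⟩ := h0.exists_div_coord j
    refine ⟨Function.update g j (genGerm E q ℓ), ?_, ?_⟩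
    · intro i
      by_cases hi : i = j
      · subst hi; simpa using isHolGerm_genGerm hFK hq hℓ
      · simpa [hi] using hg i
    · rw [Finset.sum_insert hj, h1, genGerm_congr ℓ h2]
      have h3 : genGerm E (fun z => (h fun i => if i ∈ s then 0 else Function.update z j 0 i) +
          z j * q z) ℓ = genGerm E (fun z => h fun i => if i ∈ insert j s then 0 else z i) ℓ +
          lin E (ℓ j) * genGerm E q ℓ := by
        have : ∀ z : ι → ℂ, (fun i => if i ∈ s then 0 else Function.update z j 0 i) =
            fun i => if i ∈ insert j s then 0 else z i := by
          intro z
          funext i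
          by_cases hi : i = j
          · subst hi; simp
          · simp [hi]
        simp only [this]
        rfl
      rw [h3, Function.update_self, add_assoc]
      congr 2
      refine Finset.sum_congr rfl fun i hi => ?_
      rw [Function.update_of_ne (by rintro rfl; exact hj hi)]

/-- A holomorphic germ is, modulo multiples of given independent linear forms, a holomorphic germ
in linear forms orthogonal to them. -/
lemma IsHolGerm.exists_orthogonal_add (hFK : ∀ a ∈ F, ((a : ℝ) : ℂ) ∈ K) {f : E.Germs}
    (hf : IsHolGerm E K f) (κ : Finset V) (hκ : ∀ v ∈ κ, v ∈ E.vectors) :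
    ∃ (m : ℕ) (ℓ : Fin m → V) (h : (Fin m → ℂ) → ℂ) (g : V → E.Germs),
      (∀ i, ℓ i ∈ E.vectors) ∧ LinearIndependent ℝ ℓ ∧ (∀ i, ∀ v ∈ κ, E.Q (ℓ i) v = 0) ∧
      HolAt K h ∧ (∀ v, IsHolGerm E K (g v)) ∧
      f = germOf E h ℓ + ∑ v ∈ κ, lin E v * g v := by
  classical
  obtain ⟨n, ℓ', h', hℓ', hh', rfl⟩ := hf
  obtain ⟨π, h1, h2, h3⟩ := exists_orthogonal_projection E κ hκ
  -- A basis of the span of the orthogonal components provides the independent forms of the main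
  -- term.
  let C : Submodule F V := Submodule.span F (Set.range fun i => ℓ' i - π (ℓ' i))
  have hfin : FiniteDimensional F C := FiniteDimensional.span_of_finite F (Set.finite_range _)
  have hκW : Submodule.span F (κ : Set V) ≤ E.vectors := Submodule.span_le.2 hκ
  have hCW : C ≤ E.vectors := Submodule.span_le.2 (by
    rintro _ ⟨i, rfl⟩
    exact sub_mem (hℓ' i) (hκW (h2 _ (hℓ' i))))
  have hCQ : ∀ c ∈ C, ∀ v ∈ κ, E.Q c v = 0 := by
    intro c hc v hv
    induction hc using Submodule.span_induction with
    | mem x hx =>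
      obtain ⟨i, rfl⟩ := hx
      exact h3 _ v (Submodule.subset_span hv)
    | zero => simp
    | add x y _ _ hx hy => simp [hx, hy]
    | smul a x _ hx => rw [Subfield.smul_def]; simp [hx]
  let b := Module.finBasis F C
  let ℓ : Fin (Module.finrank F C) → V := fun i => (b i : V)
  have hℓ : ∀ i, ℓ i ∈ E.vectors := fun i => hCW (b i).2
  have hspan : Submodule.span F (Set.range ℓ) = C := by
    have := congrArg (Submodule.map C.subtype) b.span_eq
    rw [Submodule.map_span, ← Set.range_comp, Submodule.map_top, Submodule.range_subtype] at this
    exact this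
  have hind : LinearIndependent ℝ ℓ := linearIndependent_real E hℓ
    (b.linearIndependent.map' C.subtype (Submodule.ker_subtype C))
  -- In these coordinates, setting the `κ`-variables to zero gives the orthogonal part, and division
  -- with remainder puts the rest in multiples of the forms of `κ`.
  let e : κ ⊕ Fin (Module.finrank F C) → V := Sum.elim (fun v => (v : V)) ℓ
  have he : ∀ i, e i ∈ E.vectors := by rintro (i | i); exacts [hκ _ i.2, hℓ i]
  have hκe : Submodule.span F (κ : Set V) ≤ Submodule.span F (Set.range e) :=
    Submodule.span_mono fun v hv => ⟨Sum.inl ⟨v, hv⟩, rfl⟩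
  have hCe : C ≤ Submodule.span F (Set.range e) := by
    refine hspan.ge.trans ?_
    exact Submodule.span_mono (by rintro _ ⟨i, rfl⟩; exact ⟨Sum.inr i, rfl⟩)
  obtain ⟨p, hp, h4⟩ := exists_genGerm_of_mem_span (E := E) hFK hh' (ℓ := ℓ') (e := e) (by
    intro i
    rw [← sub_add_cancel (ℓ' i) (π (ℓ' i))]
    exact add_mem (hCe (Submodule.subset_span ⟨i, rfl⟩)) (hκe (h2 _ (hℓ' i))))
  obtain ⟨g, hg, h5⟩ := exists_genGerm_div (E := E) hFK hp he
    (Finset.univ.map Function.Embedding.inl)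
  let q : (Fin (Module.finrank F C) → ℂ) → ℂ := fun z => p (Sum.elim (fun _ => 0) z)
  have hq : HolAt K q := by
    refine Eq.subst (motive := HolAt K) (funext fun z => congrArg p (funext fun i => ?_))
      (hp.comp_linear (κ := Fin (Module.finrank F C))
        (Sum.elim (fun _ _ => (0 : K)) fun i j => if i = j then 1 else 0))
    rcases i with i | i
    · simp
    · simp only [Sum.elim_inr]
      rw [Finset.sum_eq_single i] <;> simp +contextual [eq_comm]
  refine ⟨_, ℓ, q, fun v => if hv : v ∈ κ then g (Sum.inl ⟨v, hv⟩) else 0, hℓ, hind,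
    fun i v hv => hCQ _ (b i).2 v hv, hq, fun v => ?_, ?_⟩
  · dsimp only
    split_ifs
    exacts [hg _, isHolGerm_zero]
  · rw [h4, h5]
    congr 1
    · rw [germOf_eq_genGerm]
      simp only [genGerm, q]
      congr 1
      funext x
      congr 1
      funext i
      rcases i with i | i <;> simp [e]
    · rw [Finset.sum_map, ← Finset.sum_coe_sort κ, Finset.univ_eq_attach]
      refine Finset.sum_congr rfl fun v _ => ?_
      simp [e]

end Germs

/-! ### Reduction of denominators -/

section Denominators
variable {E : FilteredLatticeSpace F V} {K : Subfield ℂ}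

/-- The product of powers of linear forms that serves as a denominator. -/
def dprod (E : FilteredLatticeSpace F V) (κ : Finset V) (n : V → ℕ) : E.Germs :=
  ∏ α ∈ κ, lin E α ^ n α

lemma dprod_mul_inv {κ : Finset V} (hκ : ∀ α ∈ κ, α ∈ E.vectors ∧ α ≠ 0) (n : V → ℕ) :
    dprod E κ n * (dprod E κ n)⁻¹ = 1 := by
  rw [dprod, ← Finset.prod_inv_distrib, ← Finset.prod_mul_distrib]
  refine Finset.prod_eq_one fun α hα => ?_
  rw [← inv_pow, ← mul_pow, lin_mul_inv (hκ α hα).1 (hκ α hα).2, one_pow]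

lemma dprod_congr {κ : Finset V} {m n : V → ℕ} (h : ∀ α ∈ κ, m α = n α) :
    dprod E κ m = dprod E κ n :=
  Finset.prod_congr rfl fun α hα => by rw [h α hα]

lemma dprod_subset {κ' κ : Finset V} (hκ : κ' ⊆ κ) {n : V → ℕ} (h : ∀ α ∈ κ, α ∉ κ' → n α = 0) :
    dprod E κ n = dprod E κ' n :=
  (Finset.prod_subset hκ fun α hα hα' => by rw [h α hα hα', pow_zero]).symm

lemma dprod_filter_pos (κ : Finset V) (n : V → ℕ) :
    dprod E (κ.filter fun α => 0 < n α) n = dprod E κ n :=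
  (dprod_subset (Finset.filter_subset _ _) fun x hx hx' => by
    by_contra h0
    exact hx' (Finset.mem_filter.2 ⟨hx, Nat.pos_of_ne_zero h0⟩)).symm

lemma dprod_add_single [DecidableEq V] {κ : Finset V} {α : V} (hα : α ∈ κ) (m : V → ℕ) :
    dprod E κ (m + Pi.single α 1) = lin E α * dprod E κ m := by
  simp only [dprod, Pi.add_apply, pow_add, Finset.prod_mul_distrib]
  rw [Finset.prod_eq_single (f := fun x => lin E x ^ (Pi.single α 1 : V → ℕ) x) α]
  · simp [mul_comm]
  · intro j _ hj; simp [hj]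
  · exact fun h => absurd hα h

lemma lin_mul_inv_dprod [DecidableEq V] {κ : Finset V} (hκ : ∀ α ∈ κ, α ∈ E.vectors ∧ α ≠ 0)
    {α : V} (hα : α ∈ κ) (m : V → ℕ) :
    lin E α * (dprod E κ (m + Pi.single α 1))⁻¹ = (dprod E κ m)⁻¹ := by
  rw [dprod_add_single hα, mul_inv, ← mul_assoc, lin_mul_inv (hκ α hα).1 (hκ α hα).2, one_mul]

lemma sum_add_single [DecidableEq V] {κ : Finset V} {α : V} (hα : α ∈ κ) (m : V → ℕ) :
    ∑ x ∈ κ, (m + Pi.single α 1 : V → ℕ) x = ∑ x ∈ κ, m x + 1 := by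
  simp [Finset.sum_add_distrib, Finset.sum_pi_single', hα]

/-- The span of the inverse products of total order `N` over bases contained in `κ` of the span
of `κ`. -/
def basicFractions (E : FilteredLatticeSpace F V) (K : Subfield ℂ) (κ : Finset V) (N : ℕ) :
    Submodule K E.Germs :=
  Submodule.span K {f | ∃ κ' ⊆ κ, ∃ m : V → ℕ, LinearIndepOn F id (κ' : Set V) ∧
    Submodule.span F (κ' : Set V) = Submodule.span F (κ : Set V) ∧ (∀ α ∈ κ', 0 < m α) ∧
    ∑ α ∈ κ', m α = N ∧ f = (dprod E κ' m)⁻¹}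

lemma basicFractions_mono {κ' κ : Finset V} (h : κ' ⊆ κ)
    (hs : Submodule.span F (κ' : Set V) = Submodule.span F (κ : Set V)) (N : ℕ) :
    basicFractions E K κ' N ≤ basicFractions E K κ N := by
  refine Submodule.span_mono ?_
  rintro _ ⟨κ'', h1, m, h2, h3, h4, h5, rfl⟩
  exact ⟨κ'', h1.trans h, m, h2, h3.trans hs, h4, h5, rfl⟩

/-- If `β = ∑ c α • α` with the other forms, multiplying by `β / β` raises the exponent of `β` by
one and lowers that of some `α` by one in each term. The total order is preserved. Iteration
exhausts some `α`, which leaves `κ` without changing the span. -/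
lemma inv_dprod_mem_basicFractions (hFK : ∀ a ∈ F, ((a : ℝ) : ℂ) ∈ K) (κ : Finset V)
    (hκ : ∀ α ∈ κ, α ∈ E.vectors ∧ α ≠ 0) (n : V → ℕ) (hn : ∀ α ∈ κ, 0 < n α) :
    (dprod E κ n)⁻¹ ∈ basicFractions E K κ (∑ α ∈ κ, n α) := by
  classical
  induction κ using Finset.strongInduction generalizing n with
  | H κ ih =>
  by_cases hind : LinearIndepOn F id (κ : Set V)
  · exact Submodule.subset_span ⟨κ, subset_rfl, n, hind, rfl, hn, rfl, rfl⟩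
  obtain ⟨β, hβ, hβs⟩ : ∃ β ∈ κ, β ∈ Submodule.span F ((κ.erase β : Finset V) : Set V) := by
    by_contra! H
    refine hind (linearIndepOn_iff_notMem_span.2 fun β hβ => ?_)
    have := H β hβ
    rwa [Finset.coe_erase, ← Set.image_id ((κ : Set V) \ {β})] at this
  obtain ⟨c, -, hc⟩ := Submodule.mem_span_finset.1 hβs
  have step : ∀ n : V → ℕ, (dprod E κ n)⁻¹ = ∑ α ∈ κ.erase β,
      (⟨((c α : ℝ) : ℂ), hFK _ (c α).2⟩ : K) •
        (lin E α * (dprod E κ (n + Pi.single β 1))⁻¹) := by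
    intro n
    have hβl : lin E β = ∑ α ∈ κ.erase β, lin E (c α • α) := by rw [← lin_sum, hc]
    rw [← lin_mul_inv_dprod hκ hβ, hβl, Finset.sum_mul]
    refine Finset.sum_congr rfl fun α _ => ?_
    rw [lin_smul hFK, smul_mul_assoc]
  -- For fixed `κ` and `β`, each use of the relation lowers the total exponent away from `β`.
  have key : ∀ (M : ℕ) (n : V → ℕ), (∀ α ∈ κ, 0 < n α) → ∑ α ∈ κ.erase β, n α = M →
      (dprod E κ n)⁻¹ ∈ basicFractions E K κ (∑ α ∈ κ, n α) := by
    intro M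
    induction M using Nat.strong_induction_on with
    | _ M ihM =>
    intro n hn hM
    rw [step n]
    refine sum_mem fun α hα => ?_
    by_cases hcα : c α = 0
    · have : (⟨((c α : ℝ) : ℂ), hFK _ (c α).2⟩ : K) = 0 := by ext; simp [hcα]
      rw [this, zero_smul]
      exact zero_mem _
    refine Submodule.smul_mem _ _ ?_
    have hαβ : α ≠ β := (Finset.mem_erase.1 hα).1
    have hακ : α ∈ κ := (Finset.mem_erase.1 hα).2
    have hle : (Pi.single α 1 : V → ℕ) ≤ n + Pi.single β 1 := by
      intro x
      by_cases hx : x = α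
      · subst hx; simpa [hαβ] using Nat.succ_le_of_lt (hn x hακ)
      · simp [hx]
    obtain ⟨n', hn'⟩ : ∃ n' : V → ℕ, n' + Pi.single α 1 = n + Pi.single β 1 :=
      ⟨_, tsub_add_cancel_of_le hle⟩
    rw [← hn', lin_mul_inv_dprod hκ hακ]
    have hsum : ∑ x ∈ κ, n' x = ∑ x ∈ κ, n x := by
      have := congrArg (fun f : V → ℕ => ∑ x ∈ κ, f x) hn'
      simp only [sum_add_single hακ, sum_add_single hβ] at this
      omega
    have hval : ∀ x, n' x + (Pi.single α 1 : V → ℕ) x = n x + (Pi.single β 1 : V → ℕ) x :=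
      fun x => congrFun hn' x
    have hα' : n' α + 1 = n α := by simpa [hαβ] using hval α
    have hpos : ∀ x ∈ κ, x ≠ α → 0 < n' x := by
      intro x hx hxα
      have h1 := hval x
      have h2 := hn x hx
      simp only [Pi.single_apply, hxα, if_false] at h1
      omega
    rcases Nat.eq_zero_or_pos (n' α) with h0 | h0
    -- Here `α` has disappeared from the denominator. As `c α ≠ 0`, the relation expresses it
    -- through `β` and the remaining forms, so the span survives and the induction on `κ` applies.
    · have hsub : κ.erase α ⊂ κ := Finset.erase_ssubset hακ
      have h1 : dprod E κ n' = dprod E (κ.erase α) n' := dprod_subset hsub.1 fun x hx hx' => by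
        by_cases hxα : x = α
        · rw [hxα, h0]
        · exact absurd (Finset.mem_erase.2 ⟨hxα, hx⟩) hx'
      have hspan : Submodule.span F ((κ.erase α : Finset V) : Set V) =
          Submodule.span F (κ : Set V) := by
        refine le_antisymm (Submodule.span_mono (by exact_mod_cast hsub.1)) ?_
        rw [Submodule.span_le]
        intro x hx
        by_cases hxα : x = α
        · subst hxα
          have h2 : c x • x = β - ∑ y ∈ (κ.erase β).erase x, c y • y := by
            rw [eq_sub_iff_add_eq, Finset.add_sum_erase _ (fun y => c y • y) hα, hc]
          have h3 : x = (c x)⁻¹ • (β - ∑ y ∈ (κ.erase β).erase x, c y • y) := by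
            rw [← h2, smul_smul, inv_mul_cancel₀ hcα, one_smul]
          refine Eq.subst (motive := (· ∈ Submodule.span F ((κ.erase x : Finset V) : Set V)))
            h3.symm ?_
          refine Submodule.smul_mem _ _ (sub_mem (Submodule.subset_span ?_)
            (sum_mem fun y hy => Submodule.smul_mem _ _ (Submodule.subset_span ?_)))
          · exact Finset.mem_coe.2 (Finset.mem_erase.2 ⟨hαβ.symm, hβ⟩)
          · simp only [Finset.mem_erase] at hy
            exact Finset.mem_coe.2 (Finset.mem_erase.2 ⟨hy.1, hy.2.2⟩)
        · exact Submodule.subset_span (Finset.mem_coe.2 (Finset.mem_erase.2 ⟨hxα, hx⟩))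
      have h2 := ih _ hsub (fun x hx => hκ x (hsub.1 hx)) n'
        (fun x hx => hpos x (hsub.1 hx) (Finset.mem_erase.1 hx).1)
      rw [h1]
      rw [← hsum, ← Finset.add_sum_erase _ _ hακ, h0, zero_add]
      exact basicFractions_mono hsub.1 hspan _ h2
    · rw [← hsum]
      refine ihM (∑ x ∈ κ.erase β, n' x) ?_ n' (fun x hx => ?_) rfl
      · rw [← hM]
        refine Finset.sum_lt_sum (fun x hx => ?_) ⟨α, hα, by omega⟩
        have h1 := hval x
        simp only [Pi.single_apply, (Finset.mem_erase.1 hx).1, if_false] at h1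
        omega
      · by_cases hxα : x = α
        · rw [hxα]; exact h0
        · exact hpos x hx hxα
  exact key _ n hn rfl

/-! ### Polar germs and partial fractions -/

lemma isPolarGerm_of_finset {κ : Finset V} (hκ : ∀ α ∈ κ, α ∈ E.vectors)
    (hind : LinearIndepOn F id (κ : Set V)) {n : V → ℕ} (hn : ∀ α ∈ κ, 0 < n α) {m : ℕ}
    {ℓ : Fin m → V} {h : (Fin m → ℂ) → ℂ} (hℓ : ∀ i, ℓ i ∈ E.vectors)
    (hℓi : LinearIndependent ℝ ℓ) (hQ : ∀ i, ∀ α ∈ κ, E.Q (ℓ i) α = 0) (hh : HolAt K h) :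
    IsPolarGerm E K (Submodule.span F (κ : Set V)) (∑ α ∈ κ, n α)
      (germOf E h ℓ * (dprod E κ n)⁻¹) := by
  let L : Fin κ.card → V := fun i => (κ.equivFin.symm i : V)
  have hL : ∀ i, L i ∈ κ := fun i => (κ.equivFin.symm i).2
  refine ⟨m, κ.card, ℓ, L, fun i => n (L i), h, hℓ, fun i => hκ _ (hL i), hℓi, ?_,
    fun i j => hQ i _ (hL j), fun j => hn _ (hL j), hh, ?_, ?_, ?_⟩
  · refine linearIndependent_real E (fun i => hκ _ (hL i)) ?_
    exact LinearIndependent.comp hind _ κ.equivFin.symm.injective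
  · congr 1
    ext x
    constructor
    · rintro ⟨i, rfl⟩; exact hL i
    · intro hx; exact ⟨κ.equivFin ⟨x, hx⟩, by simp [L]⟩
  · rw [Equiv.sum_comp κ.equivFin.symm (fun x : κ => n x), Finset.sum_coe_sort]
  · rw [Equiv.prod_comp κ.equivFin.symm (fun x : κ => lin E (x : V) ^ n x),
      Finset.prod_coe_sort κ (fun x => lin E x ^ n x), div_eq_mul_inv]
    rfl

/-- The sum of the spaces of polar germs with supporting subspace contained in `U`. -/
def polarBelow (E : FilteredLatticeSpace F V) (K : Subfield ℂ) (U : Submodule F V) :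
    Submodule K E.Germs :=
  ⨆ i ∈ {i : Submodule F V × ℕ | i.1 ≤ U}, polarSpace E K i.1 i.2

lemma polarSpace_le_polarBelow {U' U : Submodule F V} (h : U' ≤ U) (p : ℕ) :
    polarSpace E K U' p ≤ polarBelow E K U :=
  le_biSup (fun i : Submodule F V × ℕ => polarSpace E K i.1 i.2) (i := (U', p)) h

lemma mul_mem_of_mem_span {S : Set E.Germs} {P : Submodule K E.Germs} {g x : E.Germs}
    (h : ∀ s ∈ S, g * s ∈ P) (hx : x ∈ Submodule.span K S) : g * x ∈ P := by
  induction hx using Submodule.span_induction with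
  | mem x hx => exact h x hx
  | zero => simp
  | add x y _ _ hx hy => rw [mul_add]; exact add_mem hx hy
  | smul a x _ hx => rw [mul_smul_comm]; exact Submodule.smul_mem _ _ hx

/-- Partial fractions: a quotient of a holomorphic germ by a product of linear forms is a sum of
polar germs. -/
lemma IsHolGerm.mul_inv_dprod_mem (hFK : ∀ a ∈ F, ((a : ℝ) : ℂ) ∈ K) (N : ℕ) :
    ∀ (g : E.Germs) (κ : Finset V) (n : V → ℕ), IsHolGerm E K g →
      (∀ α ∈ κ, α ∈ E.vectors ∧ α ≠ 0) → ∑ α ∈ κ, n α = N →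
      g * (dprod E κ n)⁻¹ ∈ polarBelow E K (Submodule.span F (κ : Set V)) := by
  classical
  induction N using Nat.strong_induction_on with
  | _ N ih =>
  intro g κ n hg hκ hN
  have hsub : κ.filter (fun α => 0 < n α) ⊆ κ := Finset.filter_subset _ _
  have h2 : ∑ α ∈ κ.filter (fun α => 0 < n α), n α = N := by
    rw [← hN]
    refine Finset.sum_subset hsub fun x hx hx' => ?_
    by_contra h0
    exact hx' (Finset.mem_filter.2 ⟨hx, Nat.pos_of_ne_zero h0⟩)
  have h3 := inv_dprod_mem_basicFractions (E := E) hFK _ (fun α hα => hκ α (hsub hα)) n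
    (fun α hα => (Finset.mem_filter.1 hα).2)
  rw [← dprod_filter_pos]
  rw [h2] at h3
  refine mul_mem_of_mem_span ?_ h3
  rintro _ ⟨κ', hκ', m, hind, hspan, hm, hmN, rfl⟩
  have hκW : ∀ α ∈ κ', α ∈ E.vectors ∧ α ≠ 0 := fun α hα => hκ α (hsub (hκ' hα))
  have hle : Submodule.span F (κ' : Set V) ≤ Submodule.span F (κ : Set V) :=
    Submodule.span_mono (by exact_mod_cast hκ'.trans hsub)
  obtain ⟨k, ℓ, h, q, hℓ, hℓi, hQ, hh, hq, rfl⟩ :=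
    hg.exists_orthogonal_add hFK κ' fun α hα => (hκW α hα).1
  rw [add_mul, Finset.sum_mul]
  refine add_mem ?_ (sum_mem fun v hv => ?_)
  · exact polarSpace_le_polarBelow hle _ (Submodule.subset_span
      (isPolarGerm_of_finset (fun α hα => (hκW α hα).1) hind hm hℓ hℓi hQ hh))
  -- The factor `lin E v` of the remainder cancels one pole along `v`, so the total order drops and
  -- the induction applies.
  · obtain ⟨m', rfl⟩ : ∃ m' : V → ℕ, m' + Pi.single v 1 = m :=
      ⟨_, tsub_add_cancel_of_le (a := Pi.single v 1) (fun x => by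
        by_cases hx : x = v
        · subst hx; simpa using Nat.succ_le_of_lt (hm x hv)
        · simp [hx])⟩
    rw [mul_comm (lin E v), mul_assoc, lin_mul_inv_dprod hκW hv]
    rw [sum_add_single hv] at hmN
    have := ih (∑ x ∈ κ', m' x) (by omega) (q v) κ' m' (hq v) hκW rfl
    refine (biSup_mono (fun i (hi : i.1 ≤ _) => hi.trans hle) :
      polarBelow E K (Submodule.span F (κ' : Set V)) ≤ _) this

lemma prod_lin_eq_dprod {n : ℕ} (L : Fin n → V) [DecidableEq V] :
    ∏ i, lin E (L i) = dprod E (Finset.univ.image L) fun α =>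
      (Finset.univ.filter fun i => L i = α).card :=
  Finset.prod_comp (lin E) L

lemma IsMeromorphicGerm.mem_iSup (hFK : ∀ a ∈ F, ((a : ℝ) : ℂ) ∈ K) {f : E.Germs}
    (hf : IsMeromorphicGerm E K f) :
    f ∈ ⨆ i : Submodule F V × ℕ, polarSpace E K i.1 i.2 := by
  classical
  obtain ⟨n, L, hL, hg⟩ := hf
  rw [isHolGerm_iff hFK, prod_lin_eq_dprod] at hg
  have hκ : ∀ α ∈ Finset.univ.image L, α ∈ E.vectors ∧ α ≠ 0 := by
    intro α hα
    obtain ⟨i, -, rfl⟩ := Finset.mem_image.1 hα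
    exact hL i
  have h1 := IsHolGerm.mul_inv_dprod_mem hFK _ _ _ (fun α =>
      (Finset.univ.filter fun i => L i = α).card) hg hκ rfl
  rw [mul_assoc, dprod_mul_inv hκ, mul_one] at h1
  exact (iSup₂_le fun i _ => le_iSup (fun i : Submodule F V × ℕ => polarSpace E K i.1 i.2) i) h1

lemma isMeromorphicGerm_of_fintype (hFK : ∀ a ∈ F, ((a : ℝ) : ℂ) ∈ K) {f : E.Germs} {ι : Type*}
    [Fintype ι] {L : ι → V} (hL : ∀ i, L i ∈ E.vectors ∧ L i ≠ 0)
    (h : IsHolGerm E K (f * ∏ i, lin E (L i))) : IsMeromorphicGerm E K f := by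
  refine ⟨_, L ∘ (Fintype.equivFin ι).symm, fun i => hL _, ?_⟩
  rw [isHolGerm_iff hFK]
  convert h using 2
  exact Equiv.prod_comp (Fintype.equivFin ι).symm fun i => lin E (L i)

lemma IsPolarGerm.isMeromorphicGerm (hFK : ∀ a ∈ F, ((a : ℝ) : ℂ) ∈ K) {U : Submodule F V}
    {p : ℕ} {f : E.Germs} (hf : IsPolarGerm E K U p f) : IsMeromorphicGerm E K f := by
  obtain ⟨m, n, ℓ, L, s, h, hℓ, hL, -, hLi, -, -, hh, -, -, rfl⟩ := hf
  refine isMeromorphicGerm_of_fintype hFK (ι := Σ j, Fin (s j)) (L := fun σ => L σ.1)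
    (fun σ => ⟨hL _, hLi.ne_zero _⟩) ?_
  have h1 : ∏ σ : Σ j, Fin (s j), lin E (L σ.1) = ∏ j, lin E (L j) ^ s j := by
    rw [Fintype.prod_sigma]
    simp
  have h2 : (∏ j, lin E (L j) ^ s j)⁻¹ * ∏ j, lin E (L j) ^ s j = 1 := by
    rw [← Finset.prod_inv_distrib, ← Finset.prod_mul_distrib]
    refine Finset.prod_eq_one fun j _ => ?_
    rw [← inv_pow, ← mul_pow, mul_comm, lin_mul_inv (hL j) (hLi.ne_zero j), one_pow]
  rw [h1, div_eq_mul_inv, mul_assoc, h2, mul_one]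
  exact ⟨m, ℓ, h, hℓ, hh, rfl⟩

/-- The meromorphic germs with linear poles form a subspace. -/
def meromorphicSpace (E : FilteredLatticeSpace F V) (K : Subfield ℂ)
    (hFK : ∀ a ∈ F, ((a : ℝ) : ℂ) ∈ K) : Submodule K E.Germs where
  carrier := {f | IsMeromorphicGerm E K f}
  zero_mem' := ⟨0, Fin.elim0, fun i => i.elim0, by
    rw [isHolGerm_iff hFK, zero_mul]; exact isHolGerm_zero⟩
  add_mem' := by
    rintro f g ⟨n, L, hL, hf⟩ ⟨n', L', hL', hg⟩
    rw [isHolGerm_iff hFK] at hf hg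
    refine isMeromorphicGerm_of_fintype hFK (L := Sum.elim L L')
      (by rintro (i | i); exacts [hL i, hL' i]) ?_
    simp only [Fintype.prod_sum_type, Sum.elim_inl, Sum.elim_inr]
    have h1 := hf.prod_lin_mul hFK Finset.univ (v := L') fun i _ => (hL' i).1
    have h2 := hg.prod_lin_mul hFK Finset.univ (v := L) fun i _ => (hL i).1
    convert h1.add hFK h2 using 1
    ring
  smul_mem' := by
    rintro k f ⟨n, L, hL, hf⟩
    refine ⟨n, L, hL, ?_⟩
    rw [isHolGerm_iff hFK] at hf ⊢
    rw [smul_mul_assoc]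
    exact hf.smul k

lemma mem_iSup_polarSpace_iff (hFK : ∀ a ∈ F, ((a : ℝ) : ℂ) ∈ K) (f : E.Germs) :
    f ∈ (⨆ i : Submodule F V × ℕ, polarSpace E K i.1 i.2) ↔ IsMeromorphicGerm E K f := by
  refine ⟨fun h => ?_, fun h => h.mem_iSup hFK⟩
  have : (⨆ i : Submodule F V × ℕ, polarSpace E K i.1 i.2) ≤ meromorphicSpace E K hFK :=
    iSup_le fun i => Submodule.span_le.2 fun g hg => hg.isMeromorphicGerm hFK
  exact this h

end Denominators

/-! ### Finite differences and expansions in one variable -/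

section Differences

lemma fwdDiff_commute {M G : Type*} [AddCommMonoid M] [AddCommGroup G] (a b : M) :
    Function.Commute (fwdDiff a : (M → G) → M → G) (fwdDiff b) := by
  intro f
  funext x
  simp only [fwdDiff]
  rw [add_right_comm x b a]
  abel

lemma fwdDiff_iter_zero {M G : Type*} [AddCommMonoid M] [AddCommGroup G] (a : M) (n : ℕ) :
    (fwdDiff a)^[n] (0 : M → G) = 0 :=
  Function.iterate_fixed (by funext x; simp [fwdDiff]) n

lemma tendsto_fwdDiff_iter {M : Type*} [AddCommMonoid M] {f : M → ℂ} {e : M}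
    (hf : ∀ u, Tendsto (fun n : ℕ => f (u + n • e)) atTop (𝓝 0)) (a : M) (N : ℕ) :
    ∀ u, Tendsto (fun n : ℕ => (fwdDiff a)^[N] f (u + n • e)) atTop (𝓝 0) := by
  induction N with
  | zero => exact hf
  | succ N ih =>
    intro u
    have h := (ih (u + a)).sub (ih u)
    rw [sub_zero] at h
    refine h.congr fun n => ?_
    rw [Function.iterate_succ_apply', fwdDiff, add_right_comm]

/-- If the last difference vanishes, the preceding one is periodic along `e`. It also decays along
`e`, hence is zero, and the differences peel off one by one. -/
lemma eq_zero_of_fwdDiff_iter_eq_zero {M : Type*} [AddCommMonoid M] {f : M → ℂ} {e : M} {N : ℕ}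
    (hf : ∀ u, Tendsto (fun n : ℕ => f (u + n • e)) atTop (𝓝 0))
    (h : (fwdDiff e)^[N] f = 0) : f = 0 := by
  induction N with
  | zero => exact h
  | succ N ih =>
    refine ih ?_
    have ht := tendsto_fwdDiff_iter hf e N
    rw [Function.iterate_succ_apply'] at h
    set g := (fwdDiff e)^[N] f
    have hper : ∀ u, g (u + e) = g u := fun u => sub_eq_zero.1 (congrFun h u)
    funext u
    have hconst : ∀ n : ℕ, g (u + n • e) = g u := by
      intro n
      induction n with
      | zero => simp
      | succ n ihn => rw [succ_nsmul, ← add_assoc, hper, ihn]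
    refine tendsto_nhds_unique (f := fun n : ℕ => g (u + n • e)) ?_ (ht u)
    simp only [hconst]
    exact tendsto_const_nhds

/-- A function decaying in several directions that is a sum of functions, each polynomial in one of
these directions, vanishes. -/
lemma eq_zero_of_sum_polynomial_of_tendsto {M ι : Type*} [AddCommMonoid M] (e : ι → M) (N : ι → ℕ)
    (s : Finset ι) : ∀ (f : M → ℂ) (g : ι → M → ℂ),
      (∀ i ∈ s, (fwdDiff (e i))^[N i] (g i) = 0) → f = ∑ i ∈ s, g i →
      (∀ i ∈ s, ∀ u, Tendsto (fun n : ℕ => f (u + n • e i)) atTop (𝓝 0)) → f = 0 := by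
  classical
  induction s using Finset.induction_on with
  | empty => intro f g _ h _; simpa using h
  | insert j s hj ih =>
    intro f g hg hfg hf
    -- The `N j`-th difference along `e j` kills `g j`. Because differences commute, it preserves
    -- the polynomiality of the other summands as well as the decay, so the induction hypothesis
    -- applies to it.
    refine eq_zero_of_fwdDiff_iter_eq_zero (N := N j) (hf j (Finset.mem_insert_self _ _)) ?_
    refine ih _ (fun i => (fwdDiff (e j))^[N j] (g i)) (fun i hi => ?_) ?_ fun i hi =>
      tendsto_fwdDiff_iter (hf i (Finset.mem_insert_of_mem hi)) _ _
    · have h1 := ((fwdDiff_commute (G := ℂ) (e i) (e j)).iterate_iterate (N i) (N j)) (g i)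
      rw [h1, hg i (Finset.mem_insert_of_mem hi), fwdDiff_iter_zero]
    · rw [hfg, fwdDiff_iter_finsetSum, Finset.sum_insert hj, hg j (Finset.mem_insert_self _ _),
        zero_add]

/-- Differences are transported along a map turning the shift by `e` into the shift by `ξ`. This
serves for coordinate evaluation of a covector and for parametrising translates by `ι → ℕ`. -/
lemma fwdDiff_iter_comp {M X : Type*} [AddCommMonoid M] [AddCommMonoid X] (C : X → ℂ) {A : M → X}
    {e : M} {ξ : X} (hA : ∀ u, A (u + e) = A u + ξ) (N : ℕ) :
    (fwdDiff e)^[N] (C ∘ A) = ((fwdDiff ξ)^[N] C) ∘ A := by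
  induction N generalizing C with
  | zero => rfl
  | succ N ih =>
    rw [Function.iterate_succ_apply, Function.iterate_succ_apply, ← ih]
    congr 1
    funext u
    simp [fwdDiff, hA]

lemma fwdDiff_iter_mul_invariant {X : Type*} [AddCommMonoid X] {C R : X → ℂ} {ξ : X}
    (hR : ∀ u, R (u + ξ) = R u) (N : ℕ) :
    (fwdDiff ξ)^[N] (fun u => C u * R u) = fun u => (fwdDiff ξ)^[N] C u * R u := by
  induction N generalizing C with
  | zero => rfl
  | succ N ih =>
    rw [Function.iterate_succ_apply, Function.iterate_succ_apply, ← ih]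
    congr 1
    funext u
    simp [fwdDiff, hR, sub_mul]

/-- The diagonal of an `m`-linear map is polynomial of degree at most `m`. -/
lemma fwdDiff_iter_diagonal {G : Type*} [NormedAddCommGroup G] [NormedSpace ℂ G] {m : ℕ}
    (p : ContinuousMultilinearMap ℂ (fun _ : Fin m => G) ℂ) (w : G) :
    (fwdDiff w)^[m + 1] (fun v => p fun _ => v) = 0 := by
  funext v
  -- Multilinear expansion makes the value at `v + k • w` a polynomial in `k` of degree at most `m`,
  -- which the alternating sum of order `m + 1` annihilates.
  have h1 : ∀ k : ℕ, p (fun _ => v + k • w) =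
      ∑ s : Finset (Fin m), (k : ℂ) ^ s.card * p (s.piecewise (fun _ => w) fun _ => v) := by
    intro k
    have h2 : (fun _ : Fin m => v + k • w) = (fun _ => k • w) + fun _ => v := by
      funext; simp [add_comm]
    rw [h2, ContinuousMultilinearMap.map_add_univ]
    refine Finset.sum_congr rfl fun s _ => ?_
    have h3 : s.piecewise (fun _ : Fin m => k • w) (fun _ => v) =
        s.piecewise (fun i => (k : ℂ) • s.piecewise (fun _ => w) (fun _ => v) i)
          (s.piecewise (fun _ => w) fun _ => v) := by
      funext i
      by_cases hi : i ∈ s <;> simp [hi, Nat.cast_smul_eq_nsmul]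
    rw [h3, ContinuousMultilinearMap.map_piecewise_smul]
    simp
  rw [fwdDiff_iter_eq_sum_shift]
  simp only [h1, Finset.smul_sum]
  rw [Finset.sum_comm]
  refine Finset.sum_eq_zero fun s _ => ?_
  have hs : s.card < m + 1 := by
    have := Finset.card_le_univ s
    rw [Fintype.card_fin] at this
    omega
  have h4 := congrFun (fwdDiff_iter_pow_eq_zero_of_lt (R := ℂ) hs) 0
  rw [fwdDiff_iter_eq_sum_shift] at h4
  simp only [zero_add, nsmul_eq_mul, mul_one] at h4
  have h5 := congrArg (· * p (s.piecewise (fun _ => w) fun _ => v)) h4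
  simp only [Finset.sum_mul, Pi.zero_apply, zero_mul] at h5
  rw [← h5]
  refine Finset.sum_congr rfl fun k _ => ?_
  rw [smul_mul_assoc]

/-- `g` is near zero the sum of the power series with coefficients `b`. -/
def HasExpansion (g : ℂ → ℂ) (b : ℕ → ℂ) : Prop :=
  ∀ᶠ ε in 𝓝 (0 : ℂ), HasSum (fun n => ε ^ n * b n) (g ε)

lemma HasExpansion.sum {ι : Type*} {s : Finset ι} {g : ι → ℂ → ℂ} {b : ι → ℕ → ℂ}
    (h : ∀ i ∈ s, HasExpansion (g i) (b i)) :
    HasExpansion (fun ε => ∑ i ∈ s, g i ε) fun n => ∑ i ∈ s, b i n := by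
  have h' := (Filter.eventually_all_finset s).2 h
  filter_upwards [h'] with ε hε
  simp only [Finset.mul_sum]
  exact hasSum_sum hε

lemma HasExpansion.mul_const {g : ℂ → ℂ} {b : ℕ → ℂ} (h : HasExpansion g b) (c : ℂ) :
    HasExpansion (fun ε => g ε * c) fun n => b n * c := by
  filter_upwards [h] with ε hε
  simpa [mul_assoc] using hε.mul_right c

lemma hasExpansion_const (c : ℂ) : HasExpansion (fun _ => c) (Pi.single 0 c) := by
  refine Eventually.of_forall fun ε => ?_
  have := hasSum_single (f := fun n => ε ^ n * (Pi.single 0 c : ℕ → ℂ) n) 0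
    fun n hn => by simp [hn]
  simpa using this

lemma HasExpansion.pow_mul {g : ℂ → ℂ} {b : ℕ → ℂ} (h : HasExpansion g b) (k : ℕ) :
    HasExpansion (fun ε => ε ^ k * g ε) fun n => if k ≤ n then b (n - k) else 0 := by
  filter_upwards [h] with ε hε
  have hinj : Function.Injective fun n : ℕ => n + k := add_left_injective k
  refine (hinj.hasSum_iff fun n hn => ?_).1 ?_
  · rw [if_neg, mul_zero]
    intro hk
    exact hn ⟨n - k, by simp; omega⟩
  · refine Eq.subst (motive := fun f => HasSum f (ε ^ k * g ε)) (funext fun n => ?_)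
      (hε.mul_left (ε ^ k))
    simp only [Function.comp, le_add_iff_nonneg_left, zero_le, if_true, add_tsub_cancel_right,
      pow_add]
    ring

/-- Isolation of zeros extends the vanishing across the origin, and uniqueness of power series does
the rest. The punctured hypothesis matters because polar germs are compared only for `ε ≠ 0`. -/
lemma HasExpansion.eq_zero {g : ℂ → ℂ} {b : ℕ → ℂ} (h : HasExpansion g b)
    (hg : ∀ᶠ ε in 𝓝[≠] (0 : ℂ), g ε = 0) (n : ℕ) : b n = 0 := by
  let p : FormalMultilinearSeries ℂ ℂ ℂ := fun n => ContinuousMultilinearMap.mkPiRing ℂ (Fin n) (b n)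
  have hp : HasFPowerSeriesAt g p 0 := by
    rw [hasFPowerSeriesAt_iff]
    filter_upwards [h] with ε hε
    simpa [p, FormalMultilinearSeries.coeff] using hε
  have h0 : ∀ᶠ ε in 𝓝 (0 : ℂ), g ε = 0 :=
    hp.analyticAt.frequently_zero_iff_eventually_zero.1 hg.frequently
  have hp0 : p = 0 := (hp.congr h0).eq_zero
  have := congrArg (fun q : FormalMultilinearSeries ℂ ℂ ℂ => q.coeff n) hp0
  simpa [p, FormalMultilinearSeries.coeff] using this

lemma hasExpansion_of_hasFPowerSeriesAt {G : Type*} [NormedAddCommGroup G] [NormedSpace ℂ G]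
    {f : G → ℂ} {p : FormalMultilinearSeries ℂ G ℂ} {z : G} (hp : HasFPowerSeriesAt f p z) (v : G) :
    HasExpansion (fun ε => f (z + ε • v)) fun n => p n fun _ => v := by
  have h1 : Tendsto (fun ε : ℂ => ε • v) (𝓝 0) (𝓝 0) := by
    have : Continuous fun ε : ℂ => ε • v := by fun_prop
    simpa using this.tendsto 0
  filter_upwards [h1.eventually hp.eventually_hasSum] with ε hε
  refine Eq.subst (motive := fun g => HasSum g (f (z + ε • v))) (funext fun n => ?_) hε
  rw [ContinuousMultilinearMap.map_smul_univ]
  simp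

lemma tendsto_inv_affine {a b : ℂ} (hb : b ≠ 0) :
    Tendsto (fun n : ℕ => (a + n * b)⁻¹) atTop (𝓝 0) := by
  refine tendsto_inv₀_cobounded.comp ?_
  rw [← tendsto_norm_atTop_iff_cobounded]
  have h1 : Tendsto (fun n : ℕ => (n : ℝ) * ‖b‖ - ‖a‖) atTop atTop :=
    tendsto_atTop_add_const_right _ _
      (tendsto_natCast_atTop_atTop.atTop_mul_const (norm_pos_iff.2 hb))
  refine tendsto_atTop_mono (fun n => ?_) h1
  have h2 := norm_sub_le (a + n * b) a
  rw [add_sub_cancel_left, norm_mul, Complex.norm_natCast] at h2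
  linarith

/-- A scalar avoiding countably many inhomogeneous linear equations. -/
lemma exists_scalar_avoiding {ι : Type*} [Countable ι] (a w : ι → ℂ) (ha : ∀ i, a i ≠ 0) :
    ∃ c : ℂ, c ≠ 0 ∧ ∀ i, a i + c * w i ≠ 0 := by
  have hcount : (({0} : Set ℂ) ∪ ⋃ i, {c : ℂ | a i + c * w i = 0}).Countable := by
    refine (Set.countable_singleton _).union (Set.countable_iUnion fun i => ?_)
    refine Set.Subsingleton.countable fun c hc d hd => ?_
    simp only [Set.mem_ofPred_eq] at hc hd
    have hw : w i ≠ 0 := by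
      rintro h
      rw [h, mul_zero, add_zero] at hc
      exact ha i hc
    exact mul_right_cancel₀ hw (by linear_combination hc - hd)
  obtain ⟨c, hc⟩ := (hcount.dense_compl ℂ).nonempty
  simp only [Set.mem_compl_iff, Set.mem_union, Set.mem_singleton_iff, Set.mem_iUnion,
    Set.mem_ofPred_eq, not_or, not_exists] at hc
  exact ⟨c, hc.1, hc.2⟩

end Differences

/-! ### Independence of the spaces of polar germs -/

section Independence
variable {E : FilteredLatticeSpace F V} {K : Subfield ℂ}

/-- The orthogonal projection to a rational subspace. -/
lemma exists_rational_projection (E : FilteredLatticeSpace F V) (κ : Finset V)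
    (hκ : ∀ v ∈ κ, v ∈ E.vectors) :
    ∃ π : V →ₗ[ℝ] V, (∀ v ∈ Submodule.span F (κ : Set V), π v = v) ∧
      (∀ v ∈ E.vectors, π v ∈ Submodule.span F (κ : Set V)) ∧
      (∀ v, (∀ u ∈ κ, E.Q v u = 0) → π v = 0) ∧
      ∀ b ∈ Submodule.span F (κ : Set V), ∀ v, E.Q b (π v) = E.Q b v := by
  obtain ⟨π, h1, h2, h3⟩ := exists_orthogonal_projection E κ hκ
  refine ⟨π, fun v hv => ?_, h2, fun v hv => ?_, fun b hb v => ?_⟩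
  · have hv' := span_F_le_span_R hv
    exact (sub_eq_zero.1 (eq_zero_of_Q_self E (h3 v _ (sub_mem hv' (h1 v))))).symm
  · have h4 : ∀ u ∈ Submodule.span ℝ (κ : Set V), E.Q v u = 0 := by
      intro u hu
      induction hu using Submodule.span_induction with
      | mem x hx => exact hv x hx
      | zero => simp
      | add x y _ _ hx hy => simp [hx, hy]
      | smul a x _ hx => simp [hx]
    have h5 := h3 v (π v) (h1 v)
    rw [map_sub, LinearMap.sub_apply, h4 _ (h1 v), zero_sub, neg_eq_zero] at h5
    exact eq_zero_of_Q_self E h5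
  · have h4 := h3 v b (span_F_le_span_R hb)
    rw [E.Q_symm, map_sub, sub_eq_zero] at h4
    exact h4.symm

/-- A linear form separating a rational subspace from another one. -/
lemma exists_separating_form (E : FilteredLatticeSpace F V) {κ : Finset V}
    (hκ : ∀ v ∈ κ, v ∈ E.vectors) {U' : Submodule F V}
    (hU : ¬ Submodule.span F (κ : Set V) ≤ U') :
    ∃ b ∈ Submodule.span F (κ : Set V), b ≠ 0 ∧
      ∀ v ∈ Submodule.span F (κ : Set V) ⊓ U', E.Q b v = 0 := by
  have hκW : Submodule.span F (κ : Set V) ≤ E.vectors := Submodule.span_le.2 hκ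
  have hfin : FiniteDimensional F (Submodule.span F (κ : Set V)) :=
    FiniteDimensional.span_of_finite F κ.finite_toSet
  have hfin' : FiniteDimensional F (Submodule.span F (κ : Set V) ⊓ U' : Submodule F V) :=
    Submodule.finiteDimensional_of_le inf_le_left
  obtain ⟨S, hS⟩ := (Module.Finite.iff_fg.1 hfin' :
    (Submodule.span F (κ : Set V) ⊓ U').FG)
  have hSle : Submodule.span F (S : Set V) ≤ Submodule.span F (κ : Set V) := by
    rw [hS]; exact inf_le_left
  obtain ⟨a, ha, haU⟩ := SetLike.not_le_iff_exists.1 hU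
  obtain ⟨π, -, h2, h3⟩ := exists_orthogonal_projection E S
    fun v hv => hκW (hSle (Submodule.subset_span hv))
  have hπa := h2 a (hκW ha)
  -- Take a vector `a` of the first subspace outside `U'` and remove its projection to the
  -- intersection; equality with that projection would put `a` in `U'`.
  refine ⟨a - π a, sub_mem ha (hSle hπa), ?_, fun v hv => ?_⟩
  · intro h0
    rw [sub_eq_zero] at h0
    rw [← h0, hS] at hπa
    exact haU hπa.2
  · rw [← hS] at hv
    exact h3 a v (span_F_le_span_R hv)

/-- The data defining a polar germ. -/
structure PolarDatum (E : FilteredLatticeSpace F V) (K : Subfield ℂ) where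
  (m n : ℕ)
  (ℓ : Fin m → V)
  (L : Fin n → V)
  (s : Fin n → ℕ)
  (h : (Fin m → ℂ) → ℂ)
  ℓ_mem : ∀ i, ℓ i ∈ E.vectors
  L_mem : ∀ j, L j ∈ E.vectors
  ℓ_indep : LinearIndependent ℝ ℓ
  L_indep : LinearIndependent ℝ L
  orthogonal : ∀ i j, E.Q (ℓ i) (L j) = 0
  s_pos : ∀ j, 0 < s j
  holAt : HolAt K h

namespace PolarDatum

/-- The supporting subspace. -/
def supp (d : PolarDatum E K) : Submodule F V := Submodule.span F (Set.range d.L)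

/-- The p-order. -/
def order (d : PolarDatum E K) : ℕ := ∑ j, d.s j

/-- A function representing the polar germ. -/
def fn (d : PolarDatum E K) (x : V →ₗ[ℝ] ℂ) : ℂ :=
  d.h (fun i => x (d.ℓ i)) * ∏ j, (x (d.L j) ^ d.s j)⁻¹

end PolarDatum

lemma exists_polarDatum {U : Submodule F V} {p : ℕ} {f : E.Germs} (hf : IsPolarGerm E K U p f) :
    ∃ d : PolarDatum E K, d.supp = U ∧ d.order = p ∧ f = (d.fn : (V →ₗ[ℝ] ℂ) → ℂ) := by
  obtain ⟨m, n, ℓ, L, s, h, hℓ, hL, hℓi, hLi, hQ, hs, hh, hU, hp, rfl⟩ := hf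
  refine ⟨⟨m, n, ℓ, L, s, h, hℓ, hL, hℓi, hLi, hQ, hs, hh⟩, hU, hp, ?_⟩
  rw [div_eq_mul_inv, ← Finset.prod_inv_distrib]
  have h1 : ∀ t : Finset (Fin n), (∏ j ∈ t, (lin E (L j) ^ s j)⁻¹ : E.Germs) =
      ((fun x : V →ₗ[ℝ] ℂ => ∏ j ∈ t, (x (L j) ^ s j)⁻¹ : (V →ₗ[ℝ] ℂ) → ℂ) : E.Germs) := by
    classical
    intro t
    induction t using Finset.induction_on with
    | empty => rfl
    | insert j t hj ih =>
      simp only [Finset.prod_insert hj, ih]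
      rfl
  rw [h1]
  rfl

/-- Scalars of `K` are absorbed into the numerators, so plain sums of polar germs suffice. -/
lemma exists_sum_polarDatum {U : Submodule F V} {p : ℕ} {f : E.Germs}
    (hf : f ∈ polarSpace E K U p) :
    ∃ (r : ℕ) (d : Fin r → PolarDatum E K), (∀ j, (d j).supp = U ∧ (d j).order = p) ∧
      f = ((fun x => ∑ j, (d j).fn x : (V →ₗ[ℝ] ℂ) → ℂ) : E.Germs) := by
  induction hf using Submodule.span_induction with
  | mem f hf =>
    obtain ⟨d, h1, h2, rfl⟩ := exists_polarDatum hf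
    exact ⟨1, fun _ => d, fun _ => ⟨h1, h2⟩, by simp⟩
  | zero => exact ⟨0, Fin.elim0, fun j => j.elim0, by simp; rfl⟩
  | add f g _ _ hf hg =>
    obtain ⟨r, d, hd, rfl⟩ := hf
    obtain ⟨r', d', hd', rfl⟩ := hg
    refine ⟨r + r', Fin.append d d', fun j => ?_, ?_⟩
    · refine Fin.addCases (fun j => ?_) (fun j => ?_) j
      · rw [Fin.append_left]; exact hd j
      · rw [Fin.append_right]; exact hd' j
    · simp only [Fin.sum_univ_add, Fin.append_left, Fin.append_right]
      rfl
  | smul k f _ hf =>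
    obtain ⟨r, d, hd, rfl⟩ := hf
    refine ⟨r, fun j => ⟨(d j).m, (d j).n, (d j).ℓ, (d j).L, (d j).s, fun z => k * (d j).h z,
      (d j).ℓ_mem, (d j).L_mem, (d j).ℓ_indep, (d j).L_indep, (d j).orthogonal, (d j).s_pos,
      (d j).holAt.const_mul k⟩, fun j => hd j, ?_⟩
    have : ∀ x : V →ₗ[ℝ] ℂ, k • ∑ j, (d j).fn x = ∑ j, (k : ℂ) * (d j).h (fun i => x ((d j).ℓ i)) *
        ∏ i, (x ((d j).L i) ^ (d j).s i)⁻¹ := by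
      intro x
      rw [Subfield.smul_def, smul_eq_mul, Finset.mul_sum]
      refine Finset.sum_congr rfl fun j _ => ?_
      rw [PolarDatum.fn, mul_assoc]
    simp only [PolarDatum.fn, ← this]
    rfl

namespace PolarDatum

lemma L_ne_zero (d : PolarDatum E K) (j : Fin d.n) : d.L j ≠ 0 := d.L_indep.ne_zero j

lemma Q_supp (d : PolarDatum E K) (i : Fin d.m) {u : V} (hu : u ∈ d.supp) :
    E.Q (d.ℓ i) u = 0 := by
  induction hu using Submodule.span_induction with
  | mem x hx => obtain ⟨j, rfl⟩ := hx; exact d.orthogonal i j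
  | zero => simp
  | add x y _ _ hx hy => simp [hx, hy]
  | smul a x _ hx => rw [Subfield.smul_def]; simp [hx]

/-- Expansion of a polar germ transversally to the subspace where `U` vanishes. The coefficients are
polynomial along the directions that vanish on the part of the supporting subspace in `U`. -/
lemma exists_expansion (d : PolarDatum E K) (U : Submodule F V) {y : V →ₗ[ℝ] ℂ} {A : ℕ}
    (hyU : ∀ v ∈ U, y v = 0) (hyL : ∀ j, d.L j ∉ U → y (d.L j) ≠ 0)
    (han : AnalyticAt ℂ d.h fun i => y (d.ℓ i)) (hA : d.order ≤ A) :
    ∃ C : ℕ → (V →ₗ[ℝ] ℂ) → ℂ,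
      (∀ u : V →ₗ[ℝ] ℂ, ∃ g, HasExpansion g (fun n => C n u) ∧
        ∀ᶠ ε in 𝓝[≠] (0 : ℂ), g ε = ε ^ A * d.fn (y + ε • u)) ∧
      ∀ n (ξ : V →ₗ[ℝ] ℂ), (∀ v ∈ U ⊓ d.supp, ξ v = 0) → ∃ N, (fwdDiff ξ)^[N] (C n) = 0 := by
  classical
  -- The poles in `U` vanish at `y` and contribute exactly `ε ^ (-a)` times a function of `u`. The
  -- numerator and the other poles form a function `G` analytic at `y`.
  let J : Finset (Fin d.n) := Finset.univ.filter fun j => d.L j ∈ U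
  let a : ℕ := ∑ j ∈ J, d.s j
  have haA : a ≤ A := (Finset.sum_le_sum_of_subset (Finset.filter_subset _ _)).trans hA
  let G : (Fin d.m → ℂ) × (Fin d.n → ℂ) → ℂ := fun z => d.h z.1 * ∏ j ∈ Jᶜ, (z.2 j ^ d.s j)⁻¹
  let Z : (V →ₗ[ℝ] ℂ) → (Fin d.m → ℂ) × (Fin d.n → ℂ) := fun u =>
    (fun i => u (d.ℓ i), fun j => u (d.L j))
  have hG : AnalyticAt ℂ G (Z y) := by
    refine AnalyticAt.mul (AnalyticAt.fun_comp (f := Prod.fst) han analyticAt_fst) ?_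
    refine Finset.analyticAt_fun_prod _ fun j hj => ?_
    have hj' : d.L j ∉ U := by simpa [J] using hj
    have h2 : AnalyticAt ℂ (fun z : (Fin d.m → ℂ) × (Fin d.n → ℂ) => z.2 j) (Z y) :=
      ((ContinuousLinearMap.proj (R := ℂ) (φ := fun _ : Fin d.n => ℂ) j).comp
        (ContinuousLinearMap.snd ℂ (Fin d.m → ℂ) (Fin d.n → ℂ))).analyticAt _
    exact (h2.pow _).inv (pow_ne_zero _ (hyL j hj'))
  obtain ⟨p, hp⟩ := hG
  let R : (V →ₗ[ℝ] ℂ) → ℂ := fun u => ∏ j ∈ J, (u (d.L j) ^ d.s j)⁻¹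
  refine ⟨fun n u => if A - a ≤ n then (p (n - (A - a)) fun _ => Z u) * R u else 0, fun u => ?_,
    fun n ξ hξ => ?_⟩
  · refine ⟨_, ((hasExpansion_of_hasFPowerSeriesAt hp (Z u)).mul_const (R u)).pow_mul (A - a), ?_⟩
    filter_upwards [self_mem_nhdsWithin] with ε hε
    have hε0 : ε ≠ 0 := hε
    have h1 : d.fn (y + ε • u) = G (Z y + ε • Z u) *
        ∏ j ∈ J, ((y + ε • u) (d.L j) ^ d.s j)⁻¹ := by
      rw [PolarDatum.fn, ← Finset.prod_compl_mul_prod J, ← mul_assoc]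
      rfl
    have h2 : ∏ j ∈ J, ((y + ε • u) (d.L j) ^ d.s j)⁻¹ = (ε ^ a)⁻¹ * R u := by
      rw [← Finset.prod_pow_eq_pow_sum, ← Finset.prod_inv_distrib, ← Finset.prod_mul_distrib]
      refine Finset.prod_congr rfl fun j hj => ?_
      have hj' : d.L j ∈ U := (Finset.mem_filter.1 hj).2
      rw [LinearMap.add_apply, hyU _ hj', zero_add, LinearMap.smul_apply, smul_eq_mul, mul_pow,
        mul_inv]
    have h3 : ε ^ (A - a) = ε ^ A * (ε ^ a)⁻¹ := pow_sub₀ ε hε0 haA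
    rw [h1, h2, h3]
    ring
  -- The poles collected in `R` lie in both `U` and the support, where `ξ` vanishes. Thus `R` acts
  -- as a constant for differences along `ξ`, and only the diagonal of a multilinear map remains.
  · have hR : ∀ u, R (u + ξ) = R u := fun u => by
      refine Finset.prod_congr rfl fun j hj => ?_
      rw [LinearMap.add_apply, hξ _ ⟨(Finset.mem_filter.1 hj).2, Submodule.subset_span ⟨j, rfl⟩⟩,
        add_zero]
    refine ⟨n - (A - a) + 1, ?_⟩
    by_cases hn : A - a ≤ n
    · simp only [hn, if_true]
      rw [fwdDiff_iter_mul_invariant hR (C := fun u => p (n - (A - a)) fun _ => Z u)]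
      have h4 := fwdDiff_iter_comp (fun v => p (n - (A - a)) fun _ => v) (A := Z) (e := ξ)
        (ξ := Z ξ) (fun _ => rfl) (n - (A - a) + 1)
      rw [fwdDiff_iter_diagonal] at h4
      funext u
      have h5 := congrFun h4 u
      change (fwdDiff ξ)^[n - (A - a) + 1] (fun u => p (n - (A - a)) fun _ => Z u) u = 0 at h5
      rw [h5, zero_mul]
      rfl
    · simp only [hn, if_false]
      exact fwdDiff_iter_zero _ _

/-- The numerator does not see `u` and the poles do not see `y`, so the germ is homogeneous in `ε`.
-/
lemma fn_add_smul (d : PolarDatum E K) {y u : V →ₗ[ℝ] ℂ} (hy : ∀ v ∈ d.supp, y v = 0)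
    (hu : ∀ i, u (d.ℓ i) = 0) (ε : ℂ) : d.fn (y + ε • u) = (ε ^ d.order)⁻¹ * d.fn (y + u) := by
  have hyL : ∀ j, y (d.L j) = 0 := fun j => hy _ (Submodule.subset_span ⟨j, rfl⟩)
  have h1 : ∏ j, ((y + ε • u) (d.L j) ^ d.s j)⁻¹ =
      (ε ^ d.order)⁻¹ * ∏ j, ((y + u) (d.L j) ^ d.s j)⁻¹ := by
    rw [PolarDatum.order, ← Finset.prod_pow_eq_pow_sum, ← Finset.prod_inv_distrib,
      ← Finset.prod_mul_distrib]
    refine Finset.prod_congr rfl fun j _ => ?_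
    simp [hyL, mul_pow, mul_comm]
  have h2 : (fun i => (y + ε • u) (d.ℓ i)) = fun i => (y + u) (d.ℓ i) := by
    funext i
    simp [hu]
  rw [PolarDatum.fn, PolarDatum.fn, h1, h2]
  ring

/-- The numerator is constant along `ξ`. Each pole factor is either constant or grows linearly, and
at least one grows because `ξ` does not vanish on the support. -/
lemma tendsto_fn (d : PolarDatum E K) {y u ξ : V →ₗ[ℝ] ℂ} (hy : ∀ v ∈ d.supp, y v = 0)
    (hu : ∀ i, u (d.ℓ i) = 0) (hξ : ∀ i, ξ (d.ℓ i) = 0) {v : V} (hv : v ∈ d.supp) (hξv : ξ v ≠ 0) :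
    Tendsto (fun n : ℕ => d.fn (y + (u + n • ξ))) atTop (𝓝 0) := by
  classical
  have hyL : ∀ j, y (d.L j) = 0 := fun j => hy _ (Submodule.subset_span ⟨j, rfl⟩)
  obtain ⟨j₀, hj₀⟩ : ∃ j, ξ (d.L j) ≠ 0 := by
    by_contra! H
    refine hξv ?_
    induction hv using Submodule.span_induction with
    | mem x hx => obtain ⟨j, rfl⟩ := hx; exact H j
    | zero => simp
    | add x y _ _ hx hy =>
      by_contra h
      rw [map_add] at h
      by_cases h1 : ξ x = 0
      · exact h (by rw [h1, zero_add]; by_contra h2; exact h2 (hy h2))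
      · exact h1 (hx h1)
    | smul a x _ hx =>
      by_contra h
      rw [Subfield.smul_def, map_smul] at h
      have h1 : ξ x ≠ 0 := fun h1 => h (by rw [h1, smul_zero])
      exact h1 (hx h1)
  have h1 : ∀ n : ℕ, d.fn (y + (u + n • ξ)) = d.h (fun i => y (d.ℓ i)) *
      ∏ j, ((u (d.L j) + n * ξ (d.L j))⁻¹) ^ d.s j := by
    intro n
    simp [PolarDatum.fn, hu, hξ, hyL]
  simp only [h1]
  have h2 : Tendsto (fun n : ℕ => ∏ j, ((u (d.L j) + n * ξ (d.L j))⁻¹) ^ d.s j) atTop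
      (𝓝 (∏ j, if ξ (d.L j) = 0 then ((u (d.L j))⁻¹) ^ d.s j else 0)) := by
    refine tendsto_finsetProd _ fun j _ => ?_
    split_ifs with h
    · simp only [h, mul_zero, add_zero]
      exact tendsto_const_nhds
    · have := (tendsto_inv_affine (a := u (d.L j)) h).pow (d.s j)
      rwa [zero_pow (d.s_pos j).ne'] at this
  have h3 : (∏ j, if ξ (d.L j) = 0 then ((u (d.L j))⁻¹) ^ d.s j else 0) = 0 :=
    Finset.prod_eq_zero (Finset.mem_univ j₀) (if_neg hj₀)
  rw [h3] at h2
  simpa using h2.const_mul (d.h fun i => y (d.ℓ i))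

end PolarDatum
end Independence

/-! ### Comparison of coefficients at a maximal supporting subspace -/

section Independence
variable {E : FilteredLatticeSpace F V} {K : Subfield ℂ}

/-- In a vanishing sum of polar germs, those with a given maximal supporting subspace and given
p-order sum to zero. -/
lemma eventually_sum_fn_eq_zero {Ω : Type*} [Fintype Ω] (d : Ω → PolarDatum E K)
    (h0 : ∀ᶠ x in E.offPoles, ∑ ω, (d ω).fn x = 0) {U : Submodule F V}
    (hU : ∀ ω, ¬ U < (d ω).supp) (p : ℕ) (S : Finset Ω)
    (hS : ∀ ω, ω ∈ S ↔ (d ω).supp = U ∧ (d ω).order = p) :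
    ∀ᶠ x in E.offPoles, ∑ ω ∈ S, (d ω).fn x = 0 := by
  classical
  rcases S.eq_empty_or_nonempty with rfl | ⟨ω₀, hω₀⟩
  · simp
  have hU₀ : (d ω₀).supp = U := ((hS ω₀).1 hω₀).1
  let κ : Finset V := Finset.univ.image (d ω₀).L
  have hκ : ∀ v ∈ κ, v ∈ E.vectors := by
    intro v hv
    obtain ⟨j, -, rfl⟩ := Finset.mem_image.1 hv
    exact (d ω₀).L_mem j
  have hκU : Submodule.span F (κ : Set V) = U := by
    rw [← hU₀, PolarDatum.supp, Finset.coe_image, Finset.coe_univ, Set.image_univ]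
  have hUW : U ≤ E.vectors := by rw [← hκU]; exact Submodule.span_le.2 hκ
  obtain ⟨π, hπ1, hπ2, hπ3, hπ4⟩ := exists_rational_projection E κ hκ
  rw [hκU] at hπ1 hπ2 hπ4
  have hκU' : ∀ v ∈ κ, v ∈ U := fun v hv => hκU ▸ Submodule.subset_span hv
  -- forms separating `U` from the other supporting subspaces
  let ι := {ω : Ω // (d ω).supp ≠ U}
  have hξ : ∀ i : ι, ∃ ξ : V →ₗ[ℝ] ℂ, (∀ v, ξ (π v) = ξ v) ∧ (∃ v ∈ U, ξ v ≠ 0) ∧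
      ∀ v ∈ U ⊓ (d i.1).supp, ξ v = 0 := by
    intro i
    have hle : ¬ Submodule.span F (κ : Set V) ≤ (d i.1).supp := by
      rw [hκU]
      exact fun h => hU i.1 (lt_of_le_of_ne h i.2.symm)
    obtain ⟨b, hb, hb0, hbU⟩ := exists_separating_form E hκ hle
    rw [hκU] at hb hbU
    -- The covector `Q(b, ·)` is nonzero on `U` since `Q(b, b) > 0`, vanishes on the common part of
    -- the supports, and factors through `π` since `b ∈ U`.
    refine ⟨Complex.ofRealCLM.toLinearMap ∘ₗ E.Q b, fun v => ?_, ⟨b, hb, ?_⟩, fun v hv => ?_⟩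
    · simp [hπ4 b hb v]
    · simpa using (E.Q_pos b hb0).ne'
    · simp [hbU v hv]
  choose ξ hξπ hξU hξ0 using hξ
  obtain ⟨s₀, T₀, δ, hδ, hT₀, H0⟩ := exists_of_eventually_offPoles h0
  let T : Finset V := T₀ ∪ Finset.univ.biUnion fun ω => Finset.univ.image (d ω).L
  have hT : ∀ L ∈ T, L ∈ E.vectors ∧ L ≠ 0 := by
    intro L hL
    rcases Finset.mem_union.1 hL with h | h
    · exact hT₀ L h
    · obtain ⟨ω, -, h⟩ := Finset.mem_biUnion.1 h
      obtain ⟨j, -, rfl⟩ := Finset.mem_image.1 h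
      exact ⟨(d ω).L_mem j, (d ω).L_ne_zero j⟩
  have hLT : ∀ ω j, (d ω).L j ∈ T := fun ω j =>
    Finset.mem_union_right _ (Finset.mem_biUnion.2
      ⟨ω, Finset.mem_univ _, Finset.mem_image_of_mem _ (Finset.mem_univ _)⟩)
  -- Smallness is needed only for the part of `x` vanishing on `U`; the other part will be
  -- multiplied by `ε`.
  have c1 : ∀ᶠ x : V →ₗ[ℝ] ℂ in E.offPoles, ∀ v ∈ s₀, ‖x (v - π v)‖ < δ := by
    refine (Filter.eventually_all_finset s₀).2 fun v _ => ?_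
    have h1 := tendsto_offPoles E fun _ : Unit => v - π v
    rw [tendsto_pi_nhds] at h1
    have h2 := (Metric.tendsto_nhds.1 (h1 ())) δ hδ
    simpa using h2
  have c2 : ∀ᶠ x : V →ₗ[ℝ] ℂ in E.offPoles, ∀ L ∈ T, L ∉ U → x (L - π L) ≠ 0 := by
    refine (Filter.eventually_all_finset T).2 fun L hL => ?_
    by_cases hLU : L ∈ U
    · exact Eventually.of_forall fun _ h => absurd hLU h
    · refine (eventually_apply_ne_zero (sub_mem (hT L hL).1 (hUW (hπ2 L (hT L hL).1)))
        fun h => hLU ?_).mono fun _ h _ => h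
      rw [sub_eq_zero.1 h]
      exact hπ2 L (hT L hL).1
  have c3 : ∀ᶠ x : V →ₗ[ℝ] ℂ in E.offPoles, ∀ L ∈ T, x L ≠ 0 :=
    (Filter.eventually_all_finset T).2 fun L hL =>
      eventually_apply_ne_zero (hT L hL).1 (hT L hL).2
  have c4 : ∀ᶠ x : V →ₗ[ℝ] ℂ in E.offPoles, ∀ ω,
      AnalyticAt ℂ (d ω).h fun i => x ((d ω).ℓ i - π ((d ω).ℓ i)) :=
    Filter.eventually_all.2 fun ω => (tendsto_offPoles E fun i =>
      (d ω).ℓ i - π ((d ω).ℓ i)).eventually (d ω).holAt.analyticAt.eventually_analyticAt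
  filter_upwards [c1, c2, c3, c4] with x x1 x2 x3 x4
  let y : V →ₗ[ℝ] ℂ := x ∘ₗ (LinearMap.id - π)
  let u₀ : V →ₗ[ℝ] ℂ := x ∘ₗ π
  have hy : ∀ v, y v = x (v - π v) := fun v => rfl
  have hyU : ∀ v ∈ U, y v = 0 := fun v hv => by rw [hy, hπ1 v hv, sub_self, map_zero]
  have hyu : y + u₀ = x := by
    ext v
    simp [y, u₀]
  have hππ : ∀ v, π (π v) = π v := by
    intro v
    have h1 : π (v - π v) = 0 := hπ3 _ fun b hb => by
      rw [E.Q_symm, map_sub, hπ4 b (hκU' b hb), sub_self]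
    rw [map_sub, sub_eq_zero] at h1
    exact h1.symm
  have hℓ0 : ∀ (u : V →ₗ[ℝ] ℂ), (∀ v, u (π v) = u v) → ∀ ω, (d ω).supp = U →
      ∀ i, u ((d ω).ℓ i) = 0 := by
    intro u hu ω hω i
    rw [← hu, hπ3 _ fun v hv => (d ω).Q_supp i (hω ▸ hκU' v hv), map_zero]
  -- the identity between coefficients
  let A : ℕ := ∑ ω, (d ω).order
  have hA : ∀ ω, (d ω).order ≤ A := fun ω =>
    Finset.single_le_sum (f := fun ω => (d ω).order) (fun _ _ => Nat.zero_le _) (Finset.mem_univ ω)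
  have hpA : p ≤ A := ((hS ω₀).1 hω₀).2 ▸ hA ω₀
  choose C hC1 hC2 using fun i : ι => (d i.1).exists_expansion U hyU
    (fun j hj => by rw [hy]; exact x2 _ (hLT _ j) hj) (x4 i.1) (hA i.1)
  -- This is the coefficient of `ε ^ (A - p)` in `ε ^ A` times the vanishing sum at `y + ε • u`. A
  -- germ supported on `U` contributes to it exactly when its order is `p`.
  have main : ∀ u : V →ₗ[ℝ] ℂ, (∀ v, u (π v) = u v) → (∀ L ∈ T, L ∈ U → u L ≠ 0) →
      ∑ ω ∈ S, (d ω).fn (y + u) = ∑ i : ι, -C i (A - p) u := by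
    intro u hu huT
    have hexp : ∀ ω, ∃ (g : ℂ → ℂ) (b : ℕ → ℂ), HasExpansion g b ∧
        (∀ᶠ ε in 𝓝[≠] (0 : ℂ), g ε = ε ^ A * (d ω).fn (y + ε • u)) ∧
        (∀ h : (d ω).supp = U, b (A - p) = if ω ∈ S then (d ω).fn (y + u) else 0) ∧
        ∀ h : (d ω).supp ≠ U, b (A - p) = C ⟨ω, h⟩ (A - p) u := by
      intro ω
      by_cases hω : (d ω).supp = U
      · refine ⟨_, _, (hasExpansion_const ((d ω).fn (y + u))).pow_mul (A - (d ω).order), ?_,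
          fun _ => ?_, fun h => absurd hω h⟩
        · filter_upwards [self_mem_nhdsWithin] with ε hε
          rw [(d ω).fn_add_smul (by rw [hω]; exact hyU) (hℓ0 u hu ω hω),
            pow_sub₀ ε hε (hA ω), mul_assoc]
        · have h1 := hA ω
          by_cases hp : (d ω).order = p
          · rw [if_pos ((hS ω).2 ⟨hω, hp⟩), hp, if_pos le_rfl, Nat.sub_self, Pi.single_eq_same]
          · rw [if_neg fun h => hp ((hS ω).1 h).2]
            split_ifs with h2
            · rw [Pi.single_eq_of_ne (by omega)]
            · rfl
      · obtain ⟨g, hg1, hg2⟩ := hC1 ⟨ω, hω⟩ u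
        exact ⟨g, _, hg1, hg2, fun h => absurd h hω, fun _ => rfl⟩
    choose g b hgb hg hb1 hb2 using hexp
    have hzero : ∀ᶠ ε in 𝓝[≠] (0 : ℂ), ∑ ω, g ω ε = 0 := by
      have hlim : ∀ v, Tendsto (fun ε : ℂ => (y + ε • u) v) (𝓝[≠] 0) (𝓝 (y v)) := by
        intro v
        have : Continuous fun ε : ℂ => y v + ε * u v := by fun_prop
        have h1 := this.tendsto 0
        simp only [zero_mul, add_zero] at h1
        exact h1.mono_left nhdsWithin_le_nhds
      have e1 : ∀ᶠ ε in 𝓝[≠] (0 : ℂ), ∀ v ∈ s₀, ‖(y + ε • u) v‖ < δ := by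
        refine (Filter.eventually_all_finset s₀).2 fun v hv => ?_
        refine (hlim v).norm.eventually (gt_mem_nhds ?_)
        rw [hy]
        exact x1 v hv
      have e2 : ∀ᶠ ε in 𝓝[≠] (0 : ℂ), ∀ L ∈ T₀, (y + ε • u) L ≠ 0 := by
        refine (Filter.eventually_all_finset T₀).2 fun L hL => ?_
        have hLT' : L ∈ T := Finset.mem_union_left _ hL
        by_cases hLU : L ∈ U
        · filter_upwards [self_mem_nhdsWithin] with ε hε
          rw [LinearMap.add_apply, hyU L hLU, zero_add, LinearMap.smul_apply, smul_eq_mul]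
          exact mul_ne_zero hε (huT L hLT' hLU)
        · refine (hlim L).eventually (isOpen_ne.mem_nhds ?_)
          rw [hy]
          exact x2 L hLT' hLU
      filter_upwards [e1, e2, Filter.eventually_all.2 hg] with ε h1 h2 h3
      simp only [h3]
      rw [← Finset.mul_sum, H0 _ h1 h2, mul_zero]
    have h1 := (HasExpansion.sum fun ω (_ : ω ∈ Finset.univ) => hgb ω).eq_zero hzero (A - p)
    have h2 : ∑ ω, b ω (A - p) = ∑ ω, (if ω ∈ S then (d ω).fn (y + u) else 0) +
        ∑ ω, (if h : (d ω).supp ≠ U then C ⟨ω, h⟩ (A - p) u else 0) := by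
      rw [← Finset.sum_add_distrib]
      refine Finset.sum_congr rfl fun ω _ => ?_
      by_cases hω : (d ω).supp = U
      · rw [hb1 ω hω, dif_neg (not_not.2 hω), add_zero]
      · rw [hb2 ω hω, dif_pos hω, if_neg fun h => hω ((hS ω).1 h).1, zero_add]
    have h3 : ∑ ω, (if h : (d ω).supp ≠ U then C ⟨ω, h⟩ (A - p) u else 0) =
        ∑ i : ι, C i (A - p) u := by
      rw [← Finset.sum_filter_of_ne (p := fun ω => (d ω).supp ≠ U) fun ω _ h => ?_]
      · rw [Finset.sum_subtype (p := fun ω => (d ω).supp ≠ U) _ fun ω => by simp]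
        exact Finset.sum_congr rfl fun i _ => dif_pos i.2
      · by_contra hω
        exact h (dif_neg (not_not.2 hω))
    rw [h2, h3, Finset.sum_ite_mem, Finset.univ_inter] at h1
    rw [Finset.sum_neg_distrib]
    exact eq_neg_of_add_eq_zero_left h1
  -- the lattice of translates
  obtain ⟨c, hc0, hc⟩ := exists_scalar_avoiding
    (ι := {L : V // L ∈ T.filter (· ∈ U)} × (ι → ℕ)) (fun q => u₀ q.1.1)
    (fun q => ∑ i, (q.2 i : ℂ) * ξ i q.1.1) (fun q => by
      change x (π q.1.1) ≠ 0
      have hq := Finset.mem_filter.1 q.1.2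
      rw [hπ1 _ hq.2]
      exact x3 _ hq.1)
  -- The scalar `c` avoids countably many values so that no translate meets a pole in `U`; `main`
  -- then applies at every `Γ n`. The point of interest is `Γ 0 = u₀`.
  let Γ : (ι → ℕ) → (V →ₗ[ℝ] ℂ) := fun n => u₀ + c • ∑ i, n i • ξ i
  have hΓπ : ∀ n v, Γ n (π v) = Γ n v := by
    intro n v
    simp [Γ, u₀, hππ, hξπ]
  have hΓT : ∀ n, ∀ L ∈ T, L ∈ U → Γ n L ≠ 0 := by
    intro n L hL hLU
    have := hc (⟨L, Finset.mem_filter.2 ⟨hL, hLU⟩⟩, n)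
    simpa [Γ] using this
  have hΓadd : ∀ (i : ι) n, Γ (n + Pi.single i 1) = Γ n + c • ξ i := by
    intro i n
    have h1 : ∑ j, (n + Pi.single i 1 : ι → ℕ) j • ξ j = (∑ j, n j • ξ j) + ξ i := by
      simp only [Pi.add_apply, add_smul, Finset.sum_add_distrib]
      congr 1
      rw [Finset.sum_eq_single i] <;> simp +contextual
    simp only [Γ, h1, smul_add, add_assoc]
  have key := eq_zero_of_sum_polynomial_of_tendsto (M := ι → ℕ) (fun i => Pi.single i 1)
    (fun i => (hC2 i (A - p) (c • ξ i) (fun v hv => by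
      rw [LinearMap.smul_apply, hξ0 i v hv, smul_zero])).choose) Finset.univ
    (fun n => ∑ ω ∈ S, (d ω).fn (y + Γ n)) (fun i n => -C i (A - p) (Γ n)) (fun i _ => ?_) ?_ ?_
  · have h1 := congrFun key 0
    have h2 : Γ 0 = u₀ := by simp [Γ]
    simpa only [h2, hyu, Pi.zero_apply] using h1
  · have h1 := (hC2 i (A - p) (c • ξ i) (fun v hv => by
      rw [LinearMap.smul_apply, hξ0 i v hv, smul_zero])).choose_spec
    have h2 : (fun n => -C i (A - p) (Γ n)) = (-1 : ℂ) • (C i (A - p) ∘ Γ) := by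
      funext n; simp
    rw [h2, fwdDiff_iter_const_smul, fwdDiff_iter_comp _ (hΓadd i), h1]
    funext n
    simp
  · funext n
    rw [main _ (hΓπ n) (hΓT n)]
    simp
  · intro i _ n
    have hadd : ∀ k : ℕ, Γ (n + k • Pi.single i 1) = Γ n + k • (c • ξ i) := by
      intro k
      induction k with
      | zero => simp
      | succ k ih => rw [succ_nsmul, ← add_assoc, hΓadd, ih, succ_nsmul, add_assoc]
    simp only [hadd]
    rw [← Finset.sum_const_zero (s := S)]
    refine tendsto_finsetSum _ fun ω hω => ?_
    have hω' := ((hS ω).1 hω).1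
    obtain ⟨v, hv, hv0⟩ := hξU i
    refine (d ω).tendsto_fn (by rw [hω']; exact hyU) (hℓ0 _ (hΓπ n) ω hω')
      (hℓ0 _ (fun v => by simp [hξπ]) ω hω') (hω' ▸ hv) ?_
    rw [LinearMap.smul_apply, smul_eq_mul]
    exact mul_ne_zero hc0 hv0

/-- Among the nonzero terms of a vanishing sum, one with maximal supporting subspace is isolated by
`eventually_sum_fn_eq_zero`, and so is zero. -/
lemma iSupIndep_polarSpace (E : FilteredLatticeSpace F V) (K : Subfield ℂ) :
    iSupIndep fun i : Submodule F V × ℕ => polarSpace E K i.1 i.2 := by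
  classical
  rw [iSupIndep_iff_finsetSum_eq_zero_imp_eq_zero]
  intro I f hf hsum
  by_contra! H
  let B : Finset (Submodule F V × ℕ) := I.filter fun i => f i ≠ 0
  have hB : ∀ i, i ∈ B ↔ i ∈ I ∧ f i ≠ 0 := fun i => Finset.mem_filter
  obtain ⟨i₁, hi₁, hi₁0⟩ := H
  obtain ⟨U, hUmax⟩ := (B.image Prod.fst).exists_maximal
    ⟨_, Finset.mem_image_of_mem _ ((hB i₁).2 ⟨hi₁, hi₁0⟩)⟩
  obtain ⟨i₀, hi₀, hi₀U⟩ := Finset.mem_image.1 hUmax.prop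
  have hsumB : ∑ i ∈ B, f i = 0 := by
    rw [← hsum]
    exact Finset.sum_filter_ne_zero I
  choose r d hd hfd using fun i : B => exists_sum_polarDatum (hf i.1 ((hB i.1).1 i.2).1)
  have hgerm : ∀ s : Finset B, ∑ i ∈ s, f i.1 =
      ((fun x => ∑ i ∈ s, ∑ j, (d i j).fn x : (V →ₗ[ℝ] ℂ) → ℂ) : E.Germs) := by
    intro s
    induction s using Finset.induction_on with
    | empty => simp; rfl
    | insert i s hi ih =>
      simp only [Finset.sum_insert hi, ih]
      rw [hfd i]
      rfl
  have h0 : ∀ᶠ x in E.offPoles, ∑ ω : Σ i : B, Fin (r i), (d ω.1 ω.2).fn x = 0 := by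
    have h1 := hgerm Finset.univ
    rw [Finset.sum_coe_sort B, hsumB] at h1
    have h2 := Filter.Germ.coe_eq.1 h1
    filter_upwards [h2] with x hx
    rw [Fintype.sum_sigma]
    exact hx.symm
  have h1 := eventually_sum_fn_eq_zero (fun ω : Σ i : B, Fin (r i) => d ω.1 ω.2) h0 (U := U)
    (fun ω hlt => by
      rw [(hd ω.1 ω.2).1] at hlt
      exact hlt.not_ge (hUmax.le_of_ge (Finset.mem_image_of_mem _ ω.1.2) hlt.le))
    i₀.2 (Finset.univ.image fun j => (⟨⟨i₀, hi₀⟩, j⟩ : Σ i : B, Fin (r i))) (by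
      rintro ⟨i, j⟩
      constructor
      · intro h
        obtain ⟨j', -, h⟩ := Finset.mem_image.1 h
        rw [← h]
        exact ⟨(hd ⟨i₀, hi₀⟩ j').1.trans hi₀U, (hd ⟨i₀, hi₀⟩ j').2⟩
      · rintro ⟨h1, h2⟩
        have h3 : i = ⟨i₀, hi₀⟩ := Subtype.ext (Prod.ext
          ((hd i j).1.symm.trans (h1.trans hi₀U.symm)) ((hd i j).2.symm.trans h2))
        subst h3
        exact Finset.mem_image_of_mem _ (Finset.mem_univ _))
  refine ((hB i₀).1 hi₀).2 ?_
  rw [hfd ⟨i₀, hi₀⟩]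
  refine Filter.Germ.coe_eq.2 ?_
  filter_upwards [h1] with x hx
  rw [Finset.sum_image (fun a _ b _ h => by simpa using h)] at hx
  exact hx

end Independence

/-! ### Components with respect to an independent family -/

/-- Independence makes the chosen decomposition agree with any given one. -/
lemma component_eq {R M ι : Type*} [Ring R] [AddCommGroup M] [Module R M]
    {A : ι → Submodule R M} (hA : iSupIndep A) (c : ι →₀ M) (hc : ∀ j, c j ∈ A j) (i : ι) :
    component A i (c.sum fun _ x => x) = c i := by
  classical
  have h : ∃ c' : ι →₀ M, (∀ j, c' j ∈ A j) ∧ (c'.sum fun _ x => x) = c.sum fun _ x => x :=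
    ⟨c, hc, rfl⟩
  rw [component, dif_pos h]
  obtain ⟨h1, h2⟩ := h.choose_spec
  set c' := h.choose
  have h3 : ∑ j ∈ (c' - c).support, (c' - c) j = 0 := by
    change (c' - c).sum (fun _ x => x) = 0
    rw [Finsupp.sum_sub_index (fun _ _ _ => rfl), h2, sub_self]
  have h4 := (iSupIndep_iff_finsetSum_eq_zero_imp_eq_zero A).1 hA _ (fun j => (c' - c) j)
    (fun j _ => sub_mem (h1 j) (hc j)) h3
  by_cases hi : i ∈ (c' - c).support
  · exact sub_eq_zero.1 (h4 i hi)
  · exact sub_eq_zero.1 (Finsupp.notMem_support_iff.1 hi)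

section Rational
variable {E : FilteredLatticeSpace F V} {K : Subfield ℂ} {Δ : Finset V}

/-! ### The grading by total degree -/

lemma tendsto_two_smul (E : FilteredLatticeSpace F V) :
    Tendsto (fun x : V →ₗ[ℝ] ℂ => (2 : ℂ) • x) E.offPoles E.offPoles := by
  refine tendsto_inf.2 ⟨tendsto_comap_iff.2 (tendsto_pi_nhds.2 fun v => ?_),
    tendsto_iInf.2 fun L => tendsto_iInf.2 fun hL => tendsto_principal.2 ?_⟩
  · have h1 := tendsto_pi_nhds.1 (tendsto_offPoles E fun _ : Unit => v) ()
    simpa using h1.const_mul (2 : ℂ)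
  · filter_upwards [eventually_apply_ne_zero hL.1 hL.2] with x hx
    simpa using hx

/-- The operator on germs induced by `x ↦ 2 x`. -/
def scaling (E : FilteredLatticeSpace F V) : E.Germs →+* E.Germs where
  toFun f := f.compTendsto _ (tendsto_two_smul E)
  map_one' := rfl
  map_zero' := rfl
  map_mul' f g := by
    induction f using Filter.Germ.inductionOn with | _ f =>
    induction g using Filter.Germ.inductionOn with | _ g => rfl
  map_add' f g := by
    induction f using Filter.Germ.inductionOn with | _ f =>
    induction g using Filter.Germ.inductionOn with | _ g => rfl

lemma scaling_smul (k : K) (f : E.Germs) : scaling E (k • f) = k • scaling E f := by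
  induction f using Filter.Germ.inductionOn with | _ f => rfl

/-- The scaling operator as a linear map. -/
def scalingₗ (E : FilteredLatticeSpace F V) (K : Subfield ℂ) : Module.End K E.Germs where
  toFun := scaling E
  map_add' := map_add _
  map_smul' := scaling_smul

lemma scaling_lin (v : V) : scaling E (lin E v) = (2 : K) • lin E v := by
  change (((fun x : V →ₗ[ℝ] ℂ => ((2 : ℂ) • x) v) : (V →ₗ[ℝ] ℂ) → ℂ) : E.Germs) = _
  rfl

lemma smul_prod_pow (k : K) {ι : Type*} (s : Finset ι) (f : ι → E.Germs) (n : ι → ℕ) :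
    ∏ i ∈ s, (k • f i) ^ n i = k ^ (∑ i ∈ s, n i) • ∏ i ∈ s, f i ^ n i := by
  classical
  induction s using Finset.induction_on with
  | empty => simp
  | insert i s hi ih =>
    rw [Finset.prod_insert hi, Finset.prod_insert hi, Finset.sum_insert hi, ih, smul_pow,
      smul_mul_smul_comm, pow_add]

/-- Under `x ↦ 2 x` a fraction of degree `j` is multiplied by `2 ^ j`. Degrees are thus separated by
eigenvalues, whose distinctness gives `iSupIndep_ratDeg`. -/
lemma ratDeg_le_eigenspace (hΔ : ∀ α ∈ Δ, α ∈ E.vectors ∧ α ≠ 0) (j : ℤ) :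
    ratDeg E K Δ j ≤ (scalingₗ E K).eigenspace ((2 : K) ^ j) := by
  refine Submodule.span_le.2 ?_
  rintro _ ⟨d, u, n, -, hj, rfl⟩
  rw [SetLike.mem_coe, Module.End.mem_eigenspace_iff]
  change scaling E _ = _
  have hD := dprod_mul_inv hΔ n
  set D := dprod E Δ n with hDdef
  set P : E.Germs := ∏ i, lin E (u i) with hP
  have hfrac : P / ∏ α ∈ Δ, lin E α ^ n α = P * D⁻¹ := div_eq_mul_inv _ _
  have h1 : scaling E D = (2 : K) ^ (∑ α ∈ Δ, n α) • D := by
    rw [hDdef, dprod, map_prod, ← smul_prod_pow]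
    simp only [map_pow, scaling_lin (K := K)]
  have h2 : scaling E P = (2 : K) ^ d • P := by
    have := smul_prod_pow (2 : K) Finset.univ (fun i => lin E (u i)) fun _ => 1
    simp only [pow_one, Finset.sum_const, Finset.card_univ, Fintype.card_fin, smul_eq_mul,
      mul_one] at this
    rw [hP, map_prod, ← this]
    simp only [scaling_lin (K := K)]
  rw [hfrac]
  -- The image of the inverse is never computed directly: multiply by the image of `D`, then cancel
  -- `D`.
  have h3 : scaling E (P * D⁻¹) * ((2 : K) ^ (∑ α ∈ Δ, n α) • D) = (2 : K) ^ d • P := by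
    rw [← h1, ← map_mul, mul_assoc, mul_comm D⁻¹, hD, mul_one, h2]
  have h20 : (2 : K) ≠ 0 := two_ne_zero
  have h4 : scaling E (P * D⁻¹) = ((2 : K) ^ (∑ α ∈ Δ, n α))⁻¹ • (2 : K) ^ d • (P * D⁻¹) := by
    rw [← smul_mul_assoc ((2 : K) ^ d), ← h3, mul_smul_comm, smul_mul_assoc, smul_smul,
      inv_mul_cancel₀ (pow_ne_zero _ h20), one_smul, mul_assoc, hD, mul_one]
  rw [h4, smul_smul, ← hj, zpow_sub₀ h20, mul_comm, div_eq_mul_inv]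
  congr 2
  norm_cast

lemma iSupIndep_ratDeg (hΔ : ∀ α ∈ Δ, α ∈ E.vectors ∧ α ≠ 0) : iSupIndep (ratDeg E K Δ) := by
  have hinj : Function.Injective fun j : ℤ => (2 : K) ^ j := by
    intro i j hij
    have h1 : ((2 : ℝ)) ^ i = 2 ^ j := by
      have h2 := congrArg (fun k : K => ‖K.subtype k‖) hij
      simp only [map_zpow₀, map_ofNat, norm_zpow] at h2
      simpa using h2
    exact zpow_right_injective₀ (by norm_num) (by norm_num) h1
  exact ((scalingₗ E K).eigenspaces_iSupIndep.comp hinj).mono (ratDeg_le_eigenspace hΔ)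

/-! ### The decomposition of rational functions -/

/-- The span of the generating fractions of total degree `j`. -/
def genDeg (E : FilteredLatticeSpace F V) (K : Subfield ℂ) (Δ : Finset V) (j : ℤ) :
    Submodule K E.Germs :=
  Submodule.span K {f | ∃ κ ⊆ Δ, ∃ n : V → ℕ,
    Submodule.span F (κ : Set V) = Submodule.span F (Δ : Set V) ∧ (∀ α ∈ κ, 0 < n α) ∧
    -(∑ α ∈ κ, (n α : ℤ)) = j ∧ f = (dprod E κ n)⁻¹}

lemma genDeg_le_genSpace (j : ℤ) : genDeg E K Δ j ≤ genSpace E K Δ := by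
  refine Submodule.span_mono ?_
  rintro _ ⟨κ, hκ, n, h1, h2, -, rfl⟩
  exact ⟨κ, hκ, n, h1, h2, (one_div _).symm⟩

lemma exists_extend [DecidableEq V] {κ : Finset V} (hκ : κ ⊆ Δ) (n : V → ℕ) :
    ∃ n' : V → ℕ, dprod E Δ n' = dprod E κ n ∧ ∑ α ∈ Δ, (n' α : ℤ) = ∑ α ∈ κ, (n α : ℤ) := by
  refine ⟨fun α => if α ∈ κ then n α else 0, ?_, ?_⟩
  · rw [dprod_subset hκ fun α _ h => if_neg h]
    exact dprod_congr fun α h => if_pos h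
  · rw [← Finset.sum_subset hκ fun α _ h => by simp [h]]
    exact Finset.sum_congr rfl fun α h => by simp [h]

lemma genDeg_le_ratDeg (j : ℤ) : genDeg E K Δ j ≤ ratDeg E K Δ j := by
  classical
  refine Submodule.span_mono ?_
  rintro _ ⟨κ, hκ, n, h1, h2, h3, rfl⟩
  obtain ⟨n', h4, h5⟩ := exists_extend (E := E) hκ n
  refine ⟨0, Fin.elim0, n', fun i => i.elim0, ?_, ?_⟩
  · rw [h5, ← h3]; simp
  · rw [← h4, div_eq_mul_inv, Finset.univ_eq_empty, Finset.prod_empty, one_mul]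
    rfl

lemma basicFractions_le_polarSpace {κ : Finset V} (hκ : ∀ α ∈ κ, α ∈ E.vectors) (N : ℕ) :
    basicFractions E K κ N ≤ polarSpace E K (Submodule.span F (κ : Set V)) N := by
  refine Submodule.span_mono ?_
  rintro _ ⟨κ', hκ', m, hind, hspan, hm, rfl, rfl⟩
  have h1 := isPolarGerm_of_finset (E := E) (K := K) (fun α hα => hκ α (hκ' hα)) hind hm
    (ℓ := (Fin.elim0 : Fin 0 → V)) (h := fun _ => ((1 : K) : ℂ)) (fun i => i.elim0)
    linearIndependent_empty_type (fun i => i.elim0) (holAt_const 1)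
  have h2 : germOf E (fun _ => ((1 : K) : ℂ)) (Fin.elim0 : Fin 0 → V) = 1 := rfl
  rw [h2, one_mul, hspan] at h1
  exact h1

lemma inv_dprod_mem_polarSpace (hFK : ∀ a ∈ F, ((a : ℝ) : ℂ) ∈ K) {κ : Finset V}
    (hκ : ∀ α ∈ κ, α ∈ E.vectors ∧ α ≠ 0) {n : V → ℕ} (hn : ∀ α ∈ κ, 0 < n α) :
    (dprod E κ n)⁻¹ ∈ polarSpace E K (Submodule.span F (κ : Set V)) (∑ α ∈ κ, n α) :=
  basicFractions_le_polarSpace (fun α hα => (hκ α hα).1) _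
    (inv_dprod_mem_basicFractions hFK κ hκ n hn)

lemma genSpace_le_iSup_polarSpace (hFK : ∀ a ∈ F, ((a : ℝ) : ℂ) ∈ K)
    (hΔ : ∀ α ∈ Δ, α ∈ E.vectors ∧ α ≠ 0) :
    genSpace E K Δ ≤ ⨆ i ∈ {i : Submodule F V × ℕ | i.1 = Submodule.span F (Δ : Set V)},
      polarSpace E K i.1 i.2 := by
  refine Submodule.span_le.2 ?_
  rintro _ ⟨κ, hκ, n, h1, h2, rfl⟩
  rw [one_div]
  exact Submodule.mem_iSup_of_mem (Submodule.span F (κ : Set V), ∑ α ∈ κ, n α)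
    (Submodule.mem_iSup_of_mem h1 (inv_dprod_mem_polarSpace hFK (fun α hα => hΔ α (hκ hα)) h2))

lemma genDeg_le_iSup_polarSpace (hFK : ∀ a ∈ F, ((a : ℝ) : ℂ) ∈ K)
    (hΔ : ∀ α ∈ Δ, α ∈ E.vectors ∧ α ≠ 0) {j : ℤ} {r : ℕ} (hj : j ≠ -(r : ℤ)) :
    genDeg E K Δ j ≤ ⨆ i ∈ {i : Submodule F V × ℕ | i ≠ (Submodule.span F (Δ : Set V), r)},
      polarSpace E K i.1 i.2 := by
  refine Submodule.span_le.2 ?_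
  rintro _ ⟨κ, hκ, n, h1, h2, h3, rfl⟩
  refine Submodule.mem_iSup_of_mem (Submodule.span F (κ : Set V), ∑ α ∈ κ, n α)
    (Submodule.mem_iSup_of_mem ?_ (inv_dprod_mem_polarSpace hFK (fun α hα => hΔ α (hκ hα)) h2))
  intro h
  apply hj
  have h4 : ∑ α ∈ κ, n α = r := (Prod.ext_iff.1 h).2
  rw [← h3, ← h4]
  push_cast
  rfl

lemma genDeg_le_polarSpace (hFK : ∀ a ∈ F, ((a : ℝ) : ℂ) ∈ K)
    (hΔ : ∀ α ∈ Δ, α ∈ E.vectors ∧ α ≠ 0) (r : ℕ) :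
    genDeg E K Δ (-(r : ℤ)) ≤ polarSpace E K (Submodule.span F (Δ : Set V)) r := by
  refine Submodule.span_le.2 ?_
  rintro _ ⟨κ, hκ, n, h1, h2, h3, rfl⟩
  have := inv_dprod_mem_polarSpace (E := E) hFK (fun α hα => hΔ α (hκ hα)) h2
  have h4 : ∑ α ∈ κ, n α = r := by
    rw [neg_inj] at h3
    exact_mod_cast h3
  rwa [h1, h4] at this

lemma card_eq_spanDim {κ : Finset V} (hind : LinearIndepOn F id (κ : Set V))
    (hs : Submodule.span F (κ : Set V) = Submodule.span F (Δ : Set V)) :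
    κ.card = spanDim F Δ := by
  rw [spanDim, ← hs]
  exact (finrank_span_finset_eq_card hind).symm

lemma simpleSpace_le_genDeg : simpleSpace E K Δ ≤ genDeg E K Δ (-(spanDim F Δ : ℤ)) := by
  refine Submodule.span_mono ?_
  rintro _ ⟨κ, hκ, hind, hs, rfl⟩
  refine ⟨κ, hκ, fun _ => 1, hs, fun _ _ => one_pos, ?_, ?_⟩
  · simp [card_eq_spanDim hind hs]
  · simp [dprod]

/-- Reduction to bases preserves the total order. A basis has `r` elements, so positive exponents
with sum `r` are all equal to one. -/
lemma genDeg_le_simpleSpace (hFK : ∀ a ∈ F, ((a : ℝ) : ℂ) ∈ K)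
    (hΔ : ∀ α ∈ Δ, α ∈ E.vectors ∧ α ≠ 0) :
    genDeg E K Δ (-(spanDim F Δ : ℤ)) ≤ simpleSpace E K Δ := by
  refine Submodule.span_le.2 ?_
  rintro _ ⟨κ, hκ, n, h1, h2, h3, rfl⟩
  have h4 : ∑ α ∈ κ, n α = spanDim F Δ := by
    rw [neg_inj] at h3
    exact_mod_cast h3
  have h5 := inv_dprod_mem_basicFractions (E := E) hFK κ (fun α hα => hΔ α (hκ hα)) n h2
  rw [h4] at h5
  refine (Submodule.span_le.2 ?_ : basicFractions E K κ (spanDim F Δ) ≤ _) h5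
  rintro _ ⟨κ', hκ', m, hind, hspan, hm, hmN, rfl⟩
  refine Submodule.subset_span ⟨κ', hκ'.trans hκ, hind, hspan.trans h1, ?_⟩
  have hm1 : ∀ α ∈ κ', 1 = m α := by
    refine (Finset.sum_eq_sum_iff_of_le (f := fun _ => 1) hm).1 ?_
    rw [hmN, Finset.sum_const, smul_eq_mul, mul_one, card_eq_spanDim hind (hspan.trans h1)]
  rw [one_div, dprod]
  congr 1
  exact Finset.prod_congr rfl fun α hα => by rw [← hm1 α hα, pow_one]

lemma isHolGerm_of_mem_symAlg (hFK : ∀ a ∈ F, ((a : ℝ) : ℂ) ∈ K) {U : Submodule F V}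
    (hU : U ≤ E.vectors) {f : E.Germs} (hf : f ∈ symAlg E K U) : IsHolGerm E K f := by
  induction hf using Submodule.span_induction with
  | mem f hf =>
    obtain ⟨d, u, hu, rfl⟩ := hf
    have := (isHolGerm_one (E := E) (K := K)).prod_lin_mul hFK Finset.univ (v := u)
      fun i _ => hU (hu i)
    rwa [mul_one] at this
  | zero => exact isHolGerm_zero
  | add f g _ _ hf hg => exact hf.add hFK hg
  | smul k f _ hf => exact hf.smul k

/-- Partial fractions never enlarge the span of the poles, so every support stays inside the proper
subspace spanned by `κ`. -/
lemma nonGenSpace_le_iSup_polarSpace (hFK : ∀ a ∈ F, ((a : ℝ) : ℂ) ∈ K)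
    (hΔ : ∀ α ∈ Δ, α ∈ E.vectors ∧ α ≠ 0) :
    nonGenSpace E K Δ ≤ ⨆ i ∈ {i : Submodule F V × ℕ | i.1 ≠ Submodule.span F (Δ : Set V)},
      polarSpace E K i.1 i.2 := by
  refine Submodule.span_le.2 ?_
  rintro _ ⟨κ, hκ, n, h1, h, hh, rfl⟩
  rw [div_eq_mul_inv]
  have hU : Submodule.span F (Δ : Set V) ≤ E.vectors := Submodule.span_le.2 fun α hα => (hΔ α hα).1
  have h2 := (isHolGerm_of_mem_symAlg hFK hU hh).mul_inv_dprod_mem hFK _ _ κ n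
    (fun α hα => hΔ α (hκ hα)) rfl
  have h3 : Submodule.span F (κ : Set V) ≤ Submodule.span F (Δ : Set V) :=
    Submodule.span_mono (by exact_mod_cast hκ)
  have h4 : ∀ i ∈ {i : Submodule F V × ℕ | i.1 ≤ Submodule.span F (κ : Set V)},
      i ∈ {i : Submodule F V × ℕ | i.1 ≠ Submodule.span F (Δ : Set V)} := by
    intro i hi hi'
    exact h1 (le_antisymm h3 (hi' ▸ hi))
  exact (biSup_mono h4 : polarBelow E K (Submodule.span F (κ : Set V)) ≤ _) h2

/-- Induction on the degree of the numerator. While the actual poles span `U`, a numerator factor is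
a combination of them and cancels term by term; otherwise the fraction is already non-generating.
Cancellation keeps the total degree. -/
lemma ratDeg_le (hFK : ∀ a ∈ F, ((a : ℝ) : ℂ) ∈ K) (hΔ : ∀ α ∈ Δ, α ∈ E.vectors ∧ α ≠ 0)
    (j : ℤ) : ratDeg E K Δ j ≤ (nonGenSpace E K Δ ⊓ ratDeg E K Δ j) ⊔ genDeg E K Δ j := by
  classical
  refine Submodule.span_le.2 ?_
  have hng : ∀ {d : ℕ} (u : Fin d → V) (n : V → ℕ), (∀ i, u i ∈ Submodule.span F (Δ : Set V)) →
      (d : ℤ) - ∑ α ∈ Δ, (n α : ℤ) = j →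
      Submodule.span F ((Δ.filter fun α => 0 < n α : Finset V) : Set V) ≠
        Submodule.span F (Δ : Set V) →
      (∏ i, lin E (u i)) * (dprod E Δ n)⁻¹ ∈ nonGenSpace E K Δ ⊓ ratDeg E K Δ j := by
    intro d u n hu hj hκ
    refine ⟨Submodule.subset_span ⟨_, Finset.filter_subset _ _, n, hκ, _,
      Submodule.subset_span ⟨d, u, hu, rfl⟩, ?_⟩,
      Submodule.subset_span ⟨d, u, n, hu, hj, (div_eq_mul_inv _ _).symm⟩⟩
    rw [← dprod_filter_pos, div_eq_mul_inv]
    rfl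
  have key : ∀ (d : ℕ) (u : Fin d → V) (n : V → ℕ), (∀ i, u i ∈ Submodule.span F (Δ : Set V)) →
      (d : ℤ) - ∑ α ∈ Δ, (n α : ℤ) = j → (∏ i, lin E (u i)) * (dprod E Δ n)⁻¹ ∈
        (nonGenSpace E K Δ ⊓ ratDeg E K Δ j) ⊔ genDeg E K Δ j := by
    intro d
    induction d with
    | zero =>
      intro u n hu hj
      by_cases hκ : Submodule.span F ((Δ.filter fun α => 0 < n α : Finset V) : Set V) =
        Submodule.span F (Δ : Set V)
      · refine Submodule.mem_sup_right (Submodule.subset_span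
          ⟨_, Finset.filter_subset _ _, n, hκ, fun α hα => (Finset.mem_filter.1 hα).2, ?_, ?_⟩)
        · rw [← hj, Nat.cast_zero, zero_sub, Finset.sum_filter_of_ne fun α _ h => by omega]
        · rw [Finset.univ_eq_empty, Finset.prod_empty, one_mul, dprod_filter_pos]
      · exact Submodule.mem_sup_left (hng u n hu hj hκ)
    | succ d ih =>
      intro u n hu hj
      by_cases hκ : Submodule.span F ((Δ.filter fun α => 0 < n α : Finset V) : Set V) =
        Submodule.span F (Δ : Set V)
      · obtain ⟨c, -, hc⟩ := Submodule.mem_span_finset.1 (hκ.symm ▸ hu 0)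
        rw [Fin.prod_univ_succ, ← hc, lin_sum, Finset.sum_mul, Finset.sum_mul]
        refine sum_mem fun α hα => ?_
        obtain ⟨hαΔ, hα0⟩ := Finset.mem_filter.1 hα
        obtain ⟨n', rfl⟩ : ∃ n' : V → ℕ, n' + Pi.single α 1 = n :=
          ⟨_, tsub_add_cancel_of_le (a := Pi.single α 1) (fun x => by
            by_cases hx : x = α
            · subst hx; simpa using Nat.succ_le_of_lt hα0
            · simp [hx])⟩
        rw [lin_smul hFK, smul_mul_assoc, smul_mul_assoc, mul_comm (lin E α), mul_assoc,
          lin_mul_inv_dprod hΔ hαΔ]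
        refine Submodule.smul_mem _ _ (ih (fun i => u i.succ) n' (fun i => hu _) ?_)
        have h1 := sum_add_single hαΔ n'
        have h2 : (∑ x ∈ Δ, ((n' + Pi.single α 1 : V → ℕ) x : ℤ)) = ∑ x ∈ Δ, (n' x : ℤ) + 1 := by
          exact_mod_cast h1
        rw [h2] at hj
        push_cast at hj
        linarith
      · exact Submodule.mem_sup_left (hng u n hu hj hκ)
  rintro _ ⟨d, u, n, hu, hj, rfl⟩
  rw [div_eq_mul_inv]
  exact key d u n hu hj

lemma ratSpace_eq_iSup_ratDeg (E : FilteredLatticeSpace F V) (K : Subfield ℂ) (Δ : Finset V) :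
    ratSpace E K Δ = ⨆ j, ratDeg E K Δ j := by
  refine le_antisymm (Submodule.span_le.2 ?_) (iSup_le fun j => Submodule.span_mono ?_)
  · rintro _ ⟨P, hP, n, rfl⟩
    rw [div_eq_mul_inv, mul_comm]
    refine mul_mem_of_mem_span ?_ hP
    rintro _ ⟨d, u, hu, rfl⟩
    refine Submodule.mem_iSup_of_mem _ (Submodule.subset_span ⟨d, u, n, hu, rfl, ?_⟩)
    rw [mul_comm, div_eq_mul_inv]
  · rintro _ ⟨d, u, n, hu, -, rfl⟩
    exact ⟨_, Submodule.subset_span ⟨d, u, hu, rfl⟩, n, rfl⟩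

end Rational

section Residue
variable {E : FilteredLatticeSpace F V} {K : Subfield ℂ} {Δ : Finset V}

/-! ### The Brion–Vergne decomposition and the residue -/

lemma ratDeg_le_iSup_jkSummand (hFK : ∀ a ∈ F, ((a : ℝ) : ℂ) ∈ K)
    (hΔ : ∀ α ∈ Δ, α ∈ E.vectors ∧ α ≠ 0) (j : ℤ) :
    ratDeg E K Δ j ≤ ⨆ i, jkSummand E K Δ i := by
  rcases lt_or_ge (-(spanDim F Δ : ℤ)) j with hj | hj
  · refine le_trans ?_ (le_iSup (jkSummand E K Δ) 0)
    exact le_biSup (ratDeg E K Δ) (show j ∈ {j : ℤ | -(spanDim F Δ : ℤ) < j} from hj)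
  · refine (ratDeg_le hFK hΔ j).trans (sup_le ?_ ?_)
    · refine le_trans ?_ (le_iSup (jkSummand E K Δ) 1)
      exact inf_le_inf le_rfl
        (le_biSup (ratDeg E K Δ) (show j ∈ {j : ℤ | j ≤ -(spanDim F Δ : ℤ)} from hj))
    · rcases hj.lt_or_eq with hj | rfl
      · refine le_trans ?_ (le_iSup (jkSummand E K Δ) 2)
        exact le_inf (genDeg_le_genSpace j) ((genDeg_le_ratDeg j).trans
          (le_biSup (ratDeg E K Δ) (show j ∈ {j : ℤ | j < -(spanDim F Δ : ℤ)} from hj)))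
      · exact (genDeg_le_simpleSpace hFK hΔ).trans (le_iSup (jkSummand E K Δ) 3)

lemma iSup_jkSummand (hFK : ∀ a ∈ F, ((a : ℝ) : ℂ) ∈ K)
    (hΔ : ∀ α ∈ Δ, α ∈ E.vectors ∧ α ≠ 0) : ⨆ i, jkSummand E K Δ i = ratSpace E K Δ := by
  rw [ratSpace_eq_iSup_ratDeg]
  refine le_antisymm (iSup_le fun i => ?_) (iSup_le (ratDeg_le_iSup_jkSummand hFK hΔ))
  have h : ∀ s : Set ℤ, ⨆ j ∈ s, ratDeg E K Δ j ≤ ⨆ j, ratDeg E K Δ j := fun s =>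
    iSup₂_le fun j _ => le_iSup (ratDeg E K Δ) j
  fin_cases i
  · exact h _
  · exact inf_le_right.trans (h _)
  · exact inf_le_right.trans (h _)
  · exact simpleSpace_le_genDeg.trans ((genDeg_le_ratDeg _).trans (le_iSup (ratDeg E K Δ) _))

/-- The sum of the spaces of polar germs other than `M_U^r`, where `U` is the span of `Δ` and `r`
its dimension. -/
def otherPolar (E : FilteredLatticeSpace F V) (K : Subfield ℂ) (Δ : Finset V) :
    Submodule K E.Germs :=
  ⨆ i ∈ {i : Submodule F V × ℕ | i ≠ (Submodule.span F (Δ : Set V), spanDim F Δ)},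
    polarSpace E K i.1 i.2

lemma disjoint_otherPolar :
    Disjoint (polarSpace E K (Submodule.span F (Δ : Set V)) (spanDim F Δ))
      (otherPolar E K Δ) :=
  iSupIndep_polarSpace E K (Submodule.span F (Δ : Set V), spanDim F Δ)

lemma nonGenSpace_le_otherPolar (hFK : ∀ a ∈ F, ((a : ℝ) : ℂ) ∈ K)
    (hΔ : ∀ α ∈ Δ, α ∈ E.vectors ∧ α ≠ 0) : nonGenSpace E K Δ ≤ otherPolar E K Δ :=
  (nonGenSpace_le_iSup_polarSpace hFK hΔ).trans
    (biSup_mono fun _ hi h => hi (congrArg Prod.fst h))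

lemma ratDeg_le_otherPolar (hFK : ∀ a ∈ F, ((a : ℝ) : ℂ) ∈ K)
    (hΔ : ∀ α ∈ Δ, α ∈ E.vectors ∧ α ≠ 0) {j : ℤ} (hj : j ≠ -(spanDim F Δ : ℤ)) :
    ratDeg E K Δ j ≤ otherPolar E K Δ :=
  (ratDeg_le hFK hΔ j).trans (sup_le (inf_le_left.trans (nonGenSpace_le_otherPolar hFK hΔ))
    (genDeg_le_iSup_polarSpace hFK hΔ hj))

lemma jkSummand_le_otherPolar (hFK : ∀ a ∈ F, ((a : ℝ) : ℂ) ∈ K)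
    (hΔ : ∀ α ∈ Δ, α ∈ E.vectors ∧ α ≠ 0) {i : Fin 4} (hi : i ≠ 3) :
    jkSummand E K Δ i ≤ otherPolar E K Δ := by
  fin_cases i
  · exact iSup₂_le fun j hj => ratDeg_le_otherPolar hFK hΔ (ne_of_gt hj)
  · exact inf_le_left.trans (nonGenSpace_le_otherPolar hFK hΔ)
  · exact inf_le_right.trans (iSup₂_le fun j hj => ratDeg_le_otherPolar hFK hΔ (ne_of_lt hj))
  · exact absurd rfl hi

lemma jkSummand_three_le (hFK : ∀ a ∈ F, ((a : ℝ) : ℂ) ∈ K)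
    (hΔ : ∀ α ∈ Δ, α ∈ E.vectors ∧ α ≠ 0) :
    jkSummand E K Δ 3 ≤ polarSpace E K (Submodule.span F (Δ : Set V)) (spanDim F Δ) :=
  simpleSpace_le_genDeg.trans (genDeg_le_polarSpace hFK hΔ _)

/-- In a relation, the `S_Δ` term is separated from the rest by its polar space, then the first term
by degree. The remaining two are separated by whether the supporting subspace equals `U`. -/
lemma iSupIndep_jkSummand (hFK : ∀ a ∈ F, ((a : ℝ) : ℂ) ∈ K)
    (hΔ : ∀ α ∈ Δ, α ∈ E.vectors ∧ α ≠ 0) : iSupIndep (jkSummand E K Δ) := by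
  classical
  rw [iSupIndep_iff_finsetSum_eq_zero_imp_eq_zero]
  intro s v hv hsum
  have key : ∀ w : Fin 4 → E.Germs, (∀ i, w i ∈ jkSummand E K Δ i) → ∑ i, w i = 0 →
      ∀ i, w i = 0 := by
    intro w hw h
    have h3 : w 3 = 0 := by
      refine Submodule.disjoint_def.1 disjoint_otherPolar _ (jkSummand_three_le hFK hΔ (hw 3)) ?_
      have h1 : w 3 = -(w 0 + w 1 + w 2) := by
        rw [Fin.sum_univ_four] at h
        linear_combination h
      rw [h1]
      exact neg_mem (add_mem (add_mem (jkSummand_le_otherPolar hFK hΔ (by decide) (hw 0))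
        (jkSummand_le_otherPolar hFK hΔ (by decide) (hw 1)))
        (jkSummand_le_otherPolar hFK hΔ (by decide) (hw 2)))
    rw [Fin.sum_univ_four, h3, add_zero] at h
    have h0 : w 0 = 0 := by
      have hdis := (iSupIndep_ratDeg (K := K) hΔ).disjoint_biSup_biSup
        (s := {j : ℤ | -(spanDim F Δ : ℤ) < j}) (t := {j : ℤ | j ≤ -(spanDim F Δ : ℤ)})
        (Set.disjoint_left.2 fun j (hj : _ < j) (hj' : j ≤ _) => not_lt.2 hj' hj)
      refine Submodule.disjoint_def.1 hdis _ (hw 0) ?_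
      have h1 : w 0 = -(w 1 + w 2) := by linear_combination h
      rw [h1]
      exact neg_mem (add_mem (hw 1).2 ((biSup_mono fun j (hj : j < _) => hj.le :
        ⨆ j ∈ {j : ℤ | j < -(spanDim F Δ : ℤ)}, ratDeg E K Δ j ≤
          ⨆ j ∈ {j : ℤ | j ≤ -(spanDim F Δ : ℤ)}, ratDeg E K Δ j) (hw 2).2))
    rw [h0, zero_add] at h
    have h1 : w 1 = 0 := by
      have hdis := (iSupIndep_polarSpace E K).disjoint_biSup_biSup
        (s := {i : Submodule F V × ℕ | i.1 ≠ Submodule.span F (Δ : Set V)})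
        (t := {i : Submodule F V × ℕ | i.1 = Submodule.span F (Δ : Set V)})
        (Set.disjoint_left.2 fun i hi hi' => hi hi')
      refine Submodule.disjoint_def.1 hdis _ (nonGenSpace_le_iSup_polarSpace hFK hΔ (hw 1).1) ?_
      rw [eq_neg_of_add_eq_zero_left h]
      exact neg_mem (genSpace_le_iSup_polarSpace hFK hΔ (hw 2).1)
    rw [h1, zero_add] at h
    intro i
    fin_cases i
    exacts [h0, h1, h, h3]
  have h := key (fun i => if i ∈ s then v i else 0) (fun i => by
    split_ifs with hi
    exacts [hv i hi, zero_mem _]) (by simpa using hsum)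
  intro i hi
  simpa [hi] using h i

lemma polarProj_eq {x y : E.Germs} (hx : x ∈ otherPolar E K Δ)
    (hy : y ∈ polarSpace E K (Submodule.span F (Δ : Set V)) (spanDim F Δ)) :
    polarProj E K (Submodule.span F (Δ : Set V)) (spanDim F Δ) (x + y) = y := by
  classical
  obtain ⟨c, hc, rfl⟩ := (Submodule.mem_iSup_iff_exists_finsupp _ _).1 hx
  set i₀ : Submodule F V × ℕ := (Submodule.span F (Δ : Set V), spanDim F Δ) with hi₀
  -- At the excluded index the supremum runs over a false condition, hence is the zero submodule.
  have hc0 : c i₀ = 0 := by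
    have h := hc i₀
    simpa [hi₀] using h
  have h := component_eq (iSupIndep_polarSpace E K) (c + Finsupp.single i₀ y) (fun i => ?_) i₀
  · rw [Finsupp.sum_add_index' (fun _ => rfl) (fun _ _ _ => rfl), Finsupp.sum_single_index rfl,
      Finsupp.add_apply, hc0, zero_add, Finsupp.single_eq_same] at h
    exact h
  · by_cases hi : i = i₀
    · subst hi
      rw [Finsupp.add_apply, hc0, zero_add, Finsupp.single_eq_same]
      exact hy
    · rw [Finsupp.add_apply, Finsupp.single_eq_of_ne hi, add_zero]
      exact (iSup_le fun _ => le_rfl :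
        ⨆ (_ : i ∈ {i : Submodule F V × ℕ | i ≠ i₀}), polarSpace E K i.1 i.2 ≤ _) (hc i)

lemma polarProj_eq_jkResidue (hFK : ∀ a ∈ F, ((a : ℝ) : ℂ) ∈ K)
    (hΔ : ∀ α ∈ Δ, α ∈ E.vectors ∧ α ≠ 0) {f : E.Germs} (hf : f ∈ ratSpace E K Δ) :
    polarProj E K (Submodule.span F (Δ : Set V)) (spanDim F Δ) f = jkResidue E K Δ f := by
  rw [← iSup_jkSummand hFK hΔ] at hf
  obtain ⟨c, hc, rfl⟩ := (Submodule.mem_iSup_iff_exists_finsupp _ _).1 hf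
  rw [jkResidue, component_eq (iSupIndep_jkSummand hFK hΔ) c hc]
  have h1 : (c.sum fun _ x => x) = (c 0 + c 1 + c 2) + c 3 := by
    rw [Finsupp.sum_fintype _ _ fun _ => rfl, Fin.sum_univ_four]
  rw [h1]
  exact polarProj_eq (add_mem (add_mem (jkSummand_le_otherPolar hFK hΔ (by decide) (hc 0))
    (jkSummand_le_otherPolar hFK hΔ (by decide) (hc 1)))
    (jkSummand_le_otherPolar hFK hΔ (by decide) (hc 2))) (jkSummand_three_le hFK hΔ (hc 3))

lemma ratSpace_le_iSup_polarSpace (hFK : ∀ a ∈ F, ((a : ℝ) : ℂ) ∈ K)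
    (hΔ : ∀ α ∈ Δ, α ∈ E.vectors ∧ α ≠ 0) :
    ratSpace E K Δ ≤ ⨆ i : Submodule F V × ℕ, polarSpace E K i.1 i.2 := by
  rw [← iSup_jkSummand hFK hΔ]
  refine iSup_le fun i => ?_
  by_cases hi : i = 3
  · subst hi
    exact (jkSummand_three_le hFK hΔ).trans (le_iSup
      (fun i : Submodule F V × ℕ => polarSpace E K i.1 i.2) (Submodule.span F (Δ : Set V), _))
  · exact (jkSummand_le_otherPolar hFK hΔ hi).trans (iSup₂_le fun i _ => le_iSup
      (fun i : Submodule F V × ℕ => polarSpace E K i.1 i.2) i)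

end Residue

end LinearPoles

end

theorem corollary5p7 {F : Subfield ℝ} {V : Type*} [AddCommGroup V] [Module ℝ V]
    (E : LinearPoles.FilteredLatticeSpace F V)
    (K : Subfield ℂ) (hFK : ∀ a ∈ F, (a : ℂ) ∈ K)
    (Δ : Finset V) (hΔ : ∀ α ∈ Δ, α ∈ E.vectors ∧ α ≠ 0) :
    -- the germs with linear poles are the direct sum of the spaces of polar germs with given
    -- supporting subspace and p-order
    (iSupIndep (fun i : Submodule F V × ℕ => LinearPoles.polarSpace E K i.1 i.2) ∧
      ∀ f : E.Germs, f ∈ (⨆ i : Submodule F V × ℕ, LinearPoles.polarSpace E K i.1 i.2) ↔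
        LinearPoles.IsMeromorphicGerm E K f) ∧
    -- `R_Δ` is the direct sum of the four Brion–Vergne summands
    (iSupIndep (LinearPoles.jkSummand E K Δ) ∧
      ⨆ i, LinearPoles.jkSummand E K Δ i = LinearPoles.ratSpace E K Δ) ∧
    -- on `R_Δ` the projection is defined and equals the Jeffrey–Kirwan residue
    ∀ f ∈ LinearPoles.ratSpace E K Δ, LinearPoles.IsMeromorphicGerm E K f ∧
      LinearPoles.polarProj E K (Submodule.span F (Δ : Set V)) (LinearPoles.spanDim F Δ) f =
        LinearPoles.jkResidue E K Δ f := by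
  exact ⟨⟨LinearPoles.iSupIndep_polarSpace E K, LinearPoles.mem_iSup_polarSpace_iff hFK⟩,
    ⟨LinearPoles.iSupIndep_jkSummand hFK hΔ, LinearPoles.iSup_jkSummand hFK hΔ⟩,
    fun f hf => ⟨(LinearPoles.mem_iSup_polarSpace_iff hFK f).1
      (LinearPoles.ratSpace_le_iSup_polarSpace hFK hΔ hf),
      LinearPoles.polarProj_eq_jkResidue hFK hΔ hf⟩⟩
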